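/- Fix a topological space $Z$ and a subset $Y\subset Z$. **The category.** A *preimage problem* over $(Z,Y)$ is a continuous map $f:X\to Z$. Let $\mathcal P(Z,Y)$ be the category whose objects are the pairs $(X,f)$ and whose morphisms $(X,f)\to(U,g)$ are the continuous maps $k:X\to U$ with $gk=f$, and let $\mathbf{Ab}_*$ be the category of abelian groups graded by $p=0,1,2,\dots$. **The groups.** Let $C=f^{-1}(Y)$. A *singular $p$-manifold* in a space $A$ is a continuous map $s:S\to A$ from a closed (compact, without boundary, possibly empty or disconnected) oriented smooth $p$-manifold $S$. Singular $p$-manifolds $s_0:S_0\to C$ and $s_1:S_1\to C$ are *Nielsen equivalent* if there is an oriented bordism $W$ between $S_0$ and $S_1$ (a compact oriented smooth $(p+1)$-manifold with $\partial W=S_0\sqcup -S_1$), a map $H:W\to X$ extending $s_0\sqcup s_1$ and a map $G:W\to Y$ extending $fs_0\sqcup fs_1$ such that $fH$ and $G$ are homotopic, as maps to $Z$, relative to $S_0\sqcup S_1$. * $S'_p(f)$ is the set of Nielsen equivalence classes of singular $p$-manifolds in $C$, an abelian group under disjoint union. If $gk=f$, there is a homomorphism $k'_*:S'_p(f)\to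 S'_p(g)$, $[s]\mapsto[k\circ s]$. * The *Nielsen group* $S_p(f)\subset S'_p(f)$ consists of the classes preserved by all homotopies of $f$: $z\in S_p(f)$ if and only if, for every homotopy $F:[0,1]\times X\to Z$ with $F_0=f$, the element $(i_0)'_*z$ of $S'_p(F)$ lies in the image of $(i_1)'_*:S'_p(F_1)\to S'_p(F)$, where $i_t:X\to[0,1]\times X$ is $i_t(x)=(t,x)$ and $F_t=F\circ i_t$. * $S^a_p(f)=S'_p(f)/\ker I_f$, where $I_f:S'_p(f)\to\Omega_p(Y)$, $[s]\mapsto[f\circ s]$, is the index with values in the oriented bordism group of $Y$. **Corollary.** (a) $S'_*$, $S_*$ and $S^a_*$ are functors from $\mathcal P(Z,Y)$ to $\mathbf{Ab}_*$. On a morphism $k:(X,f)\to(U,g)$ the functor $S'_*$ is given by $k'_*[s]=[k\circ s]$; the homomorphism $k_*:S_*(f)\to S_*(g)$ is the restriction of $k'_*$ to $S_*(f)$; and $k^a_*:S^a_*(f)\to S^a_*(g)$ is the homomorphism that $k'_*$ induces on the quotients. (b) If $k:(X,f)\to(U,g)$ is a morphism of $\mathcal P(Z,Y)$ such that $k:X\to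 U$ is a homotopy equivalence, then $k_*:S_*(f)\to S_*(g)$ is an isomorphism. -/

import Mathlib

/-! Oriented smooth manifolds, oriented bordism, and the Nielsen bordism groups of a preimage
problem `f : X → Z ⊃ Y`. -/

open scoped Manifold ContDiff Topology

namespace HigherNielsen

/-- The derivative of `φ` at `x`, read in the preferred charts at `x` and at `φ x`. -/
noncomputable def chartDeriv {E E' H H' : Type*} [NormedAddCommGroup E] [NormedSpace ℝ E]
    [NormedAddCommGroup E'] [NormedSpace ℝ E'] [TopologicalSpace H] [TopologicalSpace H']
    (I : ModelWithCorners ℝ E H) (J : ModelWithCorners ℝ E' H')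
    {M N : Type*} [TopologicalSpace M] [ChartedSpace H M] [TopologicalSpace N] [ChartedSpace H' N]
    (φ : M → N) (x : M) : E →L[ℝ] E' :=
  mfderiv I J φ x

theorem chartDeriv_comp {E E' E'' H H' H'' : Type*} [NormedAddCommGroup E] [NormedSpace ℝ E]
    [NormedAddCommGroup E'] [NormedSpace ℝ E'] [NormedAddCommGroup E''] [NormedSpace ℝ E'']
    [TopologicalSpace H] [TopologicalSpace H'] [TopologicalSpace H'']
    {I : ModelWithCorners ℝ E H} {J : ModelWithCorners ℝ E' H'} {L : ModelWithCorners ℝ E'' H''}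
    {M N P : Type*} [TopologicalSpace M] [ChartedSpace H M] [TopologicalSpace N] [ChartedSpace H' N]
    [TopologicalSpace P] [ChartedSpace H'' P] {f : M → N} {g : N → P} {x : M}
    (hg : MDifferentiableAt J L g (f x)) (hf : MDifferentiableAt I J f x) :
    chartDeriv I L (g ∘ f) x = (chartDeriv J L g (f x)).comp (chartDeriv I J f x) :=
  mfderiv_comp x hg hf

/-- An orientation of the manifold `M` (with or without boundary, of any dimension including `0`),
recorded by signs: the preferred chart at `x` followed by the standard orientation of the model
vector space orients `T_x M`, and `σ x` says whether the chosen orientation at `x` agrees with that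
one. The choices have to fit together: near `x` the chart at `x`, corrected by `σ x`, is an
oriented chart. -/
def IsOrientation {E H : Type*} [NormedAddCommGroup E] [NormedSpace ℝ E] [TopologicalSpace H]
    (I : ModelWithCorners ℝ E H) {M : Type*} [TopologicalSpace M] [ChartedSpace H M]
    (σ : M → ℤˣ) : Prop :=
  ∀ x : M, ∀ᶠ y in 𝓝 x,
    0 < (((σ x * σ y : ℤˣ) : ℤ) : ℝ) * 
      (chartDeriv I 𝓘(ℝ, E) (extChartAt I x) y).det

/-- A compact oriented smooth Hausdorff manifold modelled on `I`. -/
structure CompactOrientedManifold {E H : Type} [NormedAddCommGroup E] [NormedSpace ℝ E]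
    [TopologicalSpace H] (I : ModelWithCorners ℝ E H) : Type 1 where
  carrier : Type
  [top : TopologicalSpace carrier]
  [charted : ChartedSpace H carrier]
  [smooth : IsManifold I ∞ carrier]
  [compact : CompactSpace carrier]
  [hausdorff : T2Space carrier]
  orientation : carrier → ℤˣ
  isOrientation : IsOrientation I orientation

namespace CompactOrientedManifold
variable {E H : Type} [NormedAddCommGroup E] [NormedSpace ℝ E]
    [TopologicalSpace H] {I : ModelWithCorners ℝ E H}

instance : CoeSort (CompactOrientedManifold I) Type := ⟨carrier⟩

attribute [instance] top charted smooth compact hausdorff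

/-- `M` with the opposite orientation. -/
noncomputable def neg (M : CompactOrientedManifold I) : CompactOrientedManifold I where
  carrier := M
  orientation x := - M.orientation x
  isOrientation x := by
    filter_upwards [M.isOrientation x] with y hy
    simpa using hy

/-- The empty manifold. -/
noncomputable def empty : CompactOrientedManifold I where
  carrier := Empty
  charted := ChartedSpace.empty H Empty
  smooth := by
    let _ : ChartedSpace H Empty := ChartedSpace.empty H Empty
    infer_instance
  orientation x := x.elim
  isOrientation x := x.elim

/-- The disjoint union. -/
noncomputable def sum (M N : CompactOrientedManifold I) : CompactOrientedManifold I where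
  carrier := M ⊕ N
  orientation := Sum.elim M.orientation N.orientation
  isOrientation := by
    have h1 : ∀ (x y : M), y ∈ (chartAt H x).source → 
       chartDeriv I 𝓘(ℝ, E) (extChartAt I (Sum.inl x : M ⊕ N)) (Sum.inl y) = chartDeriv I 𝓘(ℝ, E) (extChartAt I x) y := by
      intro x y hy
      have hd : MDifferentiableAt I 𝓘(ℝ, E) (extChartAt I (Sum.inl x : M ⊕ N)) (Sum.inl y : M ⊕ N) := by
        apply mdifferentiableAt_extChartAt
        simpa [ChartedSpace.sum_chartAt_inl] using hy
      have h2 := mfderiv_comp (I := I) (I' := I) (I'' := 𝓘(ℝ, E)) y hd (hasMFDerivAt_inl (M' := N) (I := I) (p := Sum.inl y) (q := y)).mdifferentiableAt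
      have h3 : (extChartAt I (Sum.inl x : M ⊕ N)) ∘ Sum.inl = extChartAt I x := by
        ext z; simp
      rw [h3, mfderiv_sumInl (p := Sum.inl y)] at h2
      rw [chartDeriv, chartDeriv, h2]; rfl
    have h1' : ∀ (x y : N), y ∈ (chartAt H x).source → 
       chartDeriv I 𝓘(ℝ, E) (extChartAt I (Sum.inr x : M ⊕ N)) (Sum.inr y) = chartDeriv I 𝓘(ℝ, E) (extChartAt I x) y := by
      intro x y hy
      have hd : MDifferentiableAt I 𝓘(ℝ, E) (extChartAt I (Sum.inr x : M ⊕ N)) (Sum.inr y : M ⊕ N) := by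
        apply mdifferentiableAt_extChartAt
        simpa [ChartedSpace.sum_chartAt_inr] using hy
      have h2 := mfderiv_comp (I := I) (I' := I) (I'' := 𝓘(ℝ, E)) y hd (hasMFDerivAt_inr (M := M) (I := I) (p := Sum.inr y) (q' := y)).mdifferentiableAt
      have h3 : (extChartAt I (Sum.inr x : M ⊕ N)) ∘ Sum.inr = extChartAt I x := by
        ext z; simp
      rw [h3, mfderiv_sumInr (q' := y)] at h2
      rw [chartDeriv, chartDeriv, h2]; rfl
    rintro (x | x)
    · rw [nhds_inl, Filter.eventually_map]
      filter_upwards [M.isOrientation x, chart_source_mem_nhds H x] with y hy hs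
      rw [h1 x y hs]
      exact hy
    · rw [nhds_inr, Filter.eventually_map]
      filter_upwards [N.isOrientation x, chart_source_mem_nhds H x] with y hy hs
      rw [h1' x y hs]
      exact hy
end CompactOrientedManifold

section tools
variable {E E' H H' H'' K K' : Type*} [NormedAddCommGroup E] [NormedSpace ℝ E]
  [NormedAddCommGroup E'] [NormedSpace ℝ E']
  [TopologicalSpace H] [TopologicalSpace H'] [TopologicalSpace H'']
  [TopologicalSpace K] [TopologicalSpace K']
  {I : ModelWithCorners ℝ E H} {J : ModelWithCorners ℝ E H'} {L : ModelWithCorners ℝ E H''}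
  {I' : ModelWithCorners ℝ E' K} {J' : ModelWithCorners ℝ E' K'}
  {M N P : Type*} [TopologicalSpace M] [ChartedSpace H M]
  [TopologicalSpace N] [ChartedSpace H' N] [TopologicalSpace P] [ChartedSpace H'' P]
  {M' N' : Type*} [TopologicalSpace M'] [ChartedSpace K M']
  [TopologicalSpace N'] [ChartedSpace K' N']

variable (I J) in
/-- `φ` is a smooth local diffeomorphism at `x` that carries the orientation `σ` at `x` to the
orientation `τ` at `φ x`. -/
def OrientedLocalDiffeoAt (σ : M → ℤˣ) (τ : N → ℤˣ) (φ : M → N) (x : M) : Prop :=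
  IsLocalDiffeomorphAt I J ∞ φ x ∧
    0 < (((σ x * τ (φ x) : ℤˣ) : ℤ) : ℝ) * (chartDeriv I J φ x).det

theorem infty_ne_zero' : (∞ : WithTop ℕ∞) ≠ 0 := by simp

theorem OrientedLocalDiffeoAt.comp {σ : M → ℤˣ} {τ : N → ℤˣ} {υ : P → ℤˣ} {f : M → N} {g : N → P}
    {x : M} (hg : OrientedLocalDiffeoAt J L τ υ g (f x)) (hf : OrientedLocalDiffeoAt I J σ τ f x) :
    OrientedLocalDiffeoAt I L σ υ (g ∘ f) x := by
  refine ⟨hf.1.comp _ _ hg.1, ?_⟩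
  have hm : mfderiv I L (g ∘ f) x = (mfderiv J L g (f x)).comp (mfderiv I J f x) :=
    mfderiv_comp x (hg.1.mdifferentiableAt infty_ne_zero') (hf.1.mdifferentiableAt infty_ne_zero')
  have hd : (chartDeriv I L (g ∘ f) x).det =
     (chartDeriv J L g (f x)).det * (chartDeriv I J f x).det := by
    rw [chartDeriv, hm]; exact LinearMap.det_comp _ _
  rw [hd]
  have := mul_pos hf.2 hg.2
  have h1 : (((τ (f x) : ℤ)) : ℝ) * ((τ (f x) : ℤ) : ℝ) = 1 := by
    norm_cast; rw [Int.units_mul_self]; simp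
  push_cast at this ⊢
  simp only [Function.comp]
  linear_combination this + ((((σ x : ℤ) : ℝ)) * ((υ (g (f x)) : ℤ) : ℝ) *
     (chartDeriv J L g (f x)).det * (chartDeriv I J f x).det) * h1

theorem OrientedLocalDiffeoAt.of_comp {σ : M → ℤˣ} {τ : N → ℤˣ} {υ : P → ℤˣ} {f : M → N} {g : N → P}
    {x : M} (hf : OrientedLocalDiffeoAt I J σ τ f x)
    (hgf : OrientedLocalDiffeoAt I L σ υ (g ∘ f) x) :
    OrientedLocalDiffeoAt J L τ υ g (f x) := by
  have hl : IsLocalDiffeomorphAt J L ∞ g (f x) := by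
    obtain ⟨Ψ, hx, heq⟩ := hgf.1
    have hlx : hf.1.localInverse (f x) = x := hf.1.localInverse_left_inv hf.1.localInverse_mem_target
    refine ⟨hf.1.localInverse.trans Ψ, ⟨hf.1.localInverse_mem_source, ?_⟩, ?_⟩
    · change hf.1.localInverse (f x) ∈ Ψ.source
      rw [hlx]; exact hx
    · rintro y ⟨hy1, hy2⟩
      have h1 := heq hy2
      have h2 : f (hf.1.localInverse y) = y := hf.1.localInverse_right_inv hy1
      change g y = Ψ (hf.1.localInverse y)
      refine Eq.trans ?_ h1
      exact (congrArg g h2).symm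
  refine ⟨hl, ?_⟩
  have hm : mfderiv I L (g ∘ f) x = (mfderiv J L g (f x)).comp (mfderiv I J f x) :=
    mfderiv_comp x (hl.mdifferentiableAt infty_ne_zero') (hf.1.mdifferentiableAt infty_ne_zero')
  have hd : (chartDeriv I L (g ∘ f) x).det =
     (chartDeriv J L g (f x)).det * (chartDeriv I J f x).det := by
    rw [chartDeriv, hm]; exact LinearMap.det_comp _ _
  have h2 := hgf.2
  rw [hd] at h2
  have := mul_pos hf.2 h2
  have h1 : (((σ x : ℤ)) : ℝ) * ((σ x : ℤ) : ℝ) = 1 := by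
    norm_cast; rw [Int.units_mul_self]; simp
  push_cast at this ⊢
  simp only [Function.comp] at this
  have h3 : 0 < (((τ (f x) : ℤ) : ℝ) * ((υ (g (f x)) : ℤ) : ℝ) *
     (chartDeriv J L g (f x)).det) * ((chartDeriv I J f x).det) ^ 2 := by
    linear_combination this + (((τ (f x) : ℤ) : ℝ) * ((υ (g (f x)) : ℤ) : ℝ) *
     (chartDeriv J L g (f x)).det) * ((chartDeriv I J f x).det) ^ 2 * h1
  exact pos_of_mul_pos_left h3 (sq_nonneg _)

theorem OrientedLocalDiffeoAt.congr_orientation {σ σ' : M → ℤˣ} {τ τ' : N → ℤˣ} {f : M → N} {x : M}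
    (hf : OrientedLocalDiffeoAt I J σ τ f x) (h : σ x * τ (f x) = σ' x * τ' (f x)) :
    OrientedLocalDiffeoAt I J σ' τ' f x := by
  refine ⟨hf.1, ?_⟩
  rw [← h]; exact hf.2

theorem OrientedLocalDiffeoAt.id (σ : M → ℤˣ) (x : M) :
    OrientedLocalDiffeoAt I I σ σ (fun y => y) x := by
  refine ⟨(Diffeomorph.refl I M ∞).isLocalDiffeomorph x, ?_⟩
  have h : mfderiv I I (fun y : M => y) x = ContinuousLinearMap.id ℝ (TangentSpace I x) := mfderiv_id
  have hd : (chartDeriv I I (fun y : M => y) x).det = 1 := by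
    rw [chartDeriv, h]; exact LinearMap.det_id
  rw [hd]
  simp

theorem OrientedLocalDiffeoAt.prodMap [FiniteDimensional ℝ E] [FiniteDimensional ℝ E']
    {σ : M → ℤˣ} {τ : N → ℤˣ} {σ' : M' → ℤˣ} {τ' : N' → ℤˣ}
    {f : M → N} {g : M' → N'} {x : M × M'}
    (hf : OrientedLocalDiffeoAt I J σ τ f x.1) (hg : OrientedLocalDiffeoAt I' J' σ' τ' g x.2) :
    OrientedLocalDiffeoAt (I.prod I') (J.prod J') (fun z : M × M' => σ z.1 * σ' z.2)
      (fun z : N × N' => τ z.1 * τ' z.2) (Prod.map f g) x := by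
  have hl : IsLocalDiffeomorphAt (I.prod I') (J.prod J') ∞ (Prod.map f g) x := by
    obtain ⟨Φ, hx, he⟩ := hf.1
    obtain ⟨Ψ, hy, he'⟩ := hg.1
    refine ⟨{ toPartialEquiv := Φ.toPartialEquiv.prod Ψ.toPartialEquiv
              open_source := Φ.open_source.prod Ψ.open_source
              open_target := Φ.open_target.prod Ψ.open_target
              contMDiffOn_toFun := Φ.contMDiffOn_toFun.prodMap Ψ.contMDiffOn_toFun
              contMDiffOn_invFun := Φ.contMDiffOn_invFun.prodMap Ψ.contMDiffOn_invFun },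
            ⟨hx, hy⟩, ?_⟩
    rintro ⟨a, b⟩ ⟨ha, hb⟩
    exact Prod.ext (he ha) (he' hb)
  refine ⟨hl, ?_⟩
  have hm := mfderiv_prodMap (p := x) (hf.1.mdifferentiableAt infty_ne_zero')
    (hg.1.mdifferentiableAt infty_ne_zero')
  have hd : (chartDeriv (I.prod I') (J.prod J') (Prod.map f g) x).det =
     (chartDeriv I J f x.1).det * (chartDeriv I' J' g x.2).det := by
    rw [chartDeriv, hm]; exact LinearMap.det_prodMap _ _
  rw [hd]
  have := mul_pos hf.2 hg.2
  push_cast at this ⊢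
  simp only [Prod.map]
  linear_combination this

variable {M₂ : Type*} [TopologicalSpace M₂] [ChartedSpace H M₂]

theorem OrientedLocalDiffeoAt.inl (σ : M → ℤˣ) (τ : M₂ → ℤˣ) (x : M) :
    OrientedLocalDiffeoAt I I σ (Sum.elim σ τ) (Sum.inl : M → M ⊕ M₂) x := by
  refine ⟨⟨{ toFun := Sum.inl, invFun := Sum.elim _root_.id (fun _ => x), source := Set.univ,
             target := Set.range Sum.inl, map_source' := by simp, map_target' := by simp,
             left_inv' := by simp, right_inv' := by rintro _ ⟨a, rfl⟩; rfl,
             open_source := isOpen_univ, open_target := isOpen_range_inl,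
             contMDiffOn_toFun := ContMDiff.inl.contMDiffOn,
             contMDiffOn_invFun := (contMDiff_id.sumElim contMDiff_const).contMDiffOn },
            Set.mem_univ _, fun _ _ => rfl⟩, ?_⟩
  have hd : (chartDeriv I I (Sum.inl : M → M ⊕ M₂) x).det = 1 := by
    rw [chartDeriv, mfderiv_sumInl (p := (Sum.inl x : M ⊕ M₂))]; exact LinearMap.det_id
  rw [hd]
  simp

theorem OrientedLocalDiffeoAt.inr (σ : M → ℤˣ) (τ : M₂ → ℤˣ) (x : M₂) :
    OrientedLocalDiffeoAt I I τ (Sum.elim σ τ) (Sum.inr : M₂ → M ⊕ M₂) x := by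
  refine ⟨⟨{ toFun := Sum.inr, invFun := Sum.elim (fun _ => x) _root_.id, source := Set.univ,
             target := Set.range Sum.inr, map_source' := by simp, map_target' := by simp,
             left_inv' := by simp, right_inv' := by rintro _ ⟨a, rfl⟩; rfl,
             open_source := isOpen_univ, open_target := isOpen_range_inr,
             contMDiffOn_toFun := ContMDiff.inr.contMDiffOn,
             contMDiffOn_invFun := (contMDiff_const.sumElim contMDiff_id).contMDiffOn },
            Set.mem_univ _, fun _ _ => rfl⟩, ?_⟩
  have hd : (chartDeriv I I (Sum.inr : M₂ → M ⊕ M₂) x).det = 1 := by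
    rw [chartDeriv, mfderiv_sumInr]; exact LinearMap.det_id
  rw [hd]
  simp
end tools

section interval
open Set WithLp

/-- The standard orientation of `[0,1]`; the preferred chart at `1` is `t ↦ 1 - t`, which reverses
it. -/
noncomputable def intervalOrientation (t : Icc (0 : ℝ) 1) : ℤˣ := if (t : ℝ) < 1 then 1 else -1

theorem det_fin_one (A : EuclideanSpace ℝ (Fin 1) →L[ℝ] EuclideanSpace ℝ (Fin 1)) :
    A.det = A (EuclideanSpace.single 0 1) 0 := by
  have := LinearMap.det_toMatrix (EuclideanSpace.basisFun (Fin 1) ℝ).toBasis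
    (A : EuclideanSpace ℝ (Fin 1) →ₗ[ℝ] EuclideanSpace ℝ (Fin 1))
  rw [ContinuousLinearMap.det, ← this, Matrix.det_unique, LinearMap.toMatrix_apply]
  simp

/-- The coordinate of the one-dimensional Euclidean space. -/
noncomputable def coordOne : EuclideanSpace ℝ (Fin 1) →L[ℝ] ℝ := EuclideanSpace.proj 0

theorem mfderiv_coord {E H M : Type*} [NormedAddCommGroup E] [NormedSpace ℝ E] [TopologicalSpace H]
    {I : ModelWithCorners ℝ E H} [TopologicalSpace M] [ChartedSpace H M]
    {φ : M → EuclideanSpace ℝ (Fin 1)} {x : M}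
    (h : MDifferentiableAt I 𝓘(ℝ, EuclideanSpace ℝ (Fin 1)) φ x) (v : E) :
    (chartDeriv I 𝓘(ℝ, ℝ) (fun y => φ y 0) x) v =
      (chartDeriv I 𝓘(ℝ, EuclideanSpace ℝ (Fin 1)) φ x) v 0 := by
  have h1 := (coordOne.hasFDerivAt (x := φ x)).hasMFDerivAt
  have h2 := chartDeriv_comp h1.mdifferentiableAt h
  have h3 : chartDeriv 𝓘(ℝ, EuclideanSpace ℝ (Fin 1)) 𝓘(ℝ, ℝ) coordOne (φ x) = coordOne := h1.mfderiv
  rw [h3] at h2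
  exact congrArg (fun A : E →L[ℝ] ℝ => A v) h2

theorem chartDeriv_extChartAt_self {E H M : Type*} [NormedAddCommGroup E] [NormedSpace ℝ E]
    [TopologicalSpace H] {I : ModelWithCorners ℝ E H} [TopologicalSpace M] [ChartedSpace H M]
    [IsManifold I 1 M] (x : M) :
    chartDeriv I 𝓘(ℝ, E) (extChartAt I x) x = ContinuousLinearMap.id ℝ E :=
  mfderiv_extChartAt_self

theorem coe_mdiff (s : Icc (0 : ℝ) 1) :
    MDifferentiableAt (𝓡∂ 1) 𝓘(ℝ, ℝ) (fun t : Icc (0 : ℝ) 1 => (t : ℝ)) s :=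
  (contMDiff_subtypeVal_Icc (n := 1) s).mdifferentiableAt one_ne_zero

theorem mfderiv_intervalChart {t s : Icc (0 : ℝ) 1}
    (hs : s ∈ (chartAt (EuclideanHalfSpace 1) t).source) (v : EuclideanSpace ℝ (Fin 1)) :
    (chartDeriv (𝓡∂ 1) 𝓘(ℝ, EuclideanSpace ℝ (Fin 1)) (extChartAt (𝓡∂ 1) t) s) v 0 =
    ((intervalOrientation t : ℤ) : ℝ) *
      (chartDeriv (𝓡∂ 1) 𝓘(ℝ, ℝ) (fun t : Icc (0 : ℝ) 1 => (t : ℝ)) s) v := by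
  rw [← mfderiv_coord (mdifferentiableAt_extChartAt hs)]
  by_cases ht : (t : ℝ) < 1
  · have : (fun y => extChartAt (𝓡∂ 1) t y 0) = fun t : Icc (0 : ℝ) 1 => (t : ℝ) := by
      ext y
      simp [extChartAt, ht, IccLeftChart]
    rw [this]
    simp [intervalOrientation, ht]
  · have : (fun y => extChartAt (𝓡∂ 1) t y 0) =
        (fun r : ℝ => 1 - r) ∘ fun t : Icc (0 : ℝ) 1 => (t : ℝ) := by
      ext y
      simp [extChartAt, ht, IccRightChart]
    rw [this]
    have h1 : HasMFDerivAt 𝓘(ℝ, ℝ) 𝓘(ℝ, ℝ) (fun r : ℝ => 1 - r) (s : ℝ)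
        (-(ContinuousLinearMap.id ℝ ℝ)) :=
      ((hasFDerivAt_id (𝕜 := ℝ) (s : ℝ)).const_sub 1).hasMFDerivAt
    have h2 : chartDeriv 𝓘(ℝ, ℝ) 𝓘(ℝ, ℝ) (fun r : ℝ => 1 - r) (s : ℝ) =
      -(ContinuousLinearMap.id ℝ ℝ) := h1.mfderiv
    rw [chartDeriv_comp h1.mdifferentiableAt (coe_mdiff s), h2]
    simp [intervalOrientation, ht]

theorem mfderiv_intervalCoe (s : Icc (0 : ℝ) 1) (v : EuclideanSpace ℝ (Fin 1)) :
    (chartDeriv (𝓡∂ 1) 𝓘(ℝ, ℝ) (fun t : Icc (0 : ℝ) 1 => (t : ℝ)) s) v = ((intervalOrientation s : ℤ) : ℝ) * v 0 := by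
  have h := mfderiv_intervalChart (mem_chart_source (EuclideanHalfSpace 1) s) v
  rw [chartDeriv_extChartAt_self] at h
  have h1 : (((intervalOrientation s : ℤ)) : ℝ) * ((intervalOrientation s : ℤ) : ℝ) = 1 := by
    norm_cast; rw [Int.units_mul_self]; simp
  change v 0 = _ at h
  rw [h, ← mul_assoc, h1, one_mul]

theorem isOrientation_interval : IsOrientation (𝓡∂ 1) intervalOrientation := by
  intro t
  filter_upwards [chart_source_mem_nhds (EuclideanHalfSpace 1) t] with s hs
  rw [det_fin_one, mfderiv_intervalChart hs, mfderiv_intervalCoe]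
  have h1 (s) : (((intervalOrientation s : ℤ)) : ℝ) * ((intervalOrientation s : ℤ) : ℝ) = 1 := by
    norm_cast; rw [Int.units_mul_self]; simp
  have h2 := h1 s
  have h3 := h1 t
  push_cast
  refine lt_of_lt_of_eq one_pos ?_
  simp only [PiLp.single_apply, if_true]
  linear_combination -h3 - ((intervalOrientation t : ℤ) : ℝ) ^ 2 * h2

theorem IsOrientation.prod {E E' H K M N : Type*} [NormedAddCommGroup E] [NormedSpace ℝ E]
    [NormedAddCommGroup E'] [NormedSpace ℝ E'] [FiniteDimensional ℝ E] [FiniteDimensional ℝ E']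
    [TopologicalSpace H] [TopologicalSpace K]
    {I : ModelWithCorners ℝ E H} {J : ModelWithCorners ℝ E' K}
    [TopologicalSpace M] [ChartedSpace H M] [TopologicalSpace N] [ChartedSpace K N]
    [IsManifold I 1 M] [IsManifold J 1 N]
    {σ : M → ℤˣ} {τ : N → ℤˣ} (hσ : IsOrientation I σ) (hτ : IsOrientation J τ) :
    IsOrientation (I.prod J) (fun z : M × N => σ z.1 * τ z.2) := by
  rintro ⟨x, y⟩
  have h1 := (hσ x).and (chart_source_mem_nhds H x)
  have h2 := (hτ y).and (chart_source_mem_nhds K y)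
  rw [nhds_prod_eq]
  filter_upwards [h1.prod_mk h2] with ⟨x', y'⟩ ⟨⟨h1, h1'⟩, h2, h2'⟩
  have hm := mfderiv_prodMap (p := (x', y')) (mdifferentiableAt_extChartAt (I := I) h1')
    (mdifferentiableAt_extChartAt (I := J) h2')
  have he : (extChartAt (I.prod J) (x, y) : M × N → E × E') =
      Prod.map (extChartAt I x) (extChartAt J y) := by
    rw [extChartAt_prod]; rfl
  have hd : (chartDeriv (I.prod J) 𝓘(ℝ, E × E') (extChartAt (I.prod J) (x, y)) (x', y')).det =
     (chartDeriv I 𝓘(ℝ, E) (extChartAt I x) x').det *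
      (chartDeriv J 𝓘(ℝ, E') (extChartAt J y) y').det := by
    rw [he, chartDeriv, modelWithCornersSelf_prod, ← chartedSpaceSelf_prod, hm]; exact LinearMap.det_prodMap _ _
  rw [hd]
  have := mul_pos h1 h2
  push_cast at this ⊢
  linear_combination this

/-- The embedding `x ↦ x / (2 (1 + x))` of `[0,∞)` onto `[0,1/2)`. -/
noncomputable def collarParam (x : EuclideanHalfSpace 1) : Icc (0 : ℝ) 1 :=
  ⟨x.1 0 / (2 * (1 + x.1 0)), by
    have := x.2
    constructor
    · positivity
    · rw [div_le_one (by positivity)]; linarith⟩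

theorem collarParam_lt (x : EuclideanHalfSpace 1) : (collarParam x : ℝ) < 1 / 2 := by
  have := x.2
  change x.1 0 / (2 * (1 + x.1 0)) < 1 / 2
  rw [div_lt_div_iff₀ (by positivity) (by positivity)]; linarith

/-- The inverse of `collarParam`. -/
noncomputable def collarParamInv (t : Icc (0 : ℝ) 1) : EuclideanHalfSpace 1 :=
  (𝓡∂ 1).symm (toLp 2 fun _ => 2 * (t : ℝ) / (1 - 2 * t))

theorem collarParamInv_coe {t : Icc (0 : ℝ) 1} (h : (t : ℝ) < 1 / 2) :
    (collarParamInv t).1 0 = 2 * (t : ℝ) / (1 - 2 * t) := by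
  have := t.2.1
  simp only [collarParamInv, modelWithCornersEuclideanHalfSpace_symm_apply]
  simp
  apply div_nonneg
  · linarith
  · linarith

theorem halfSpace_ext {x y : EuclideanHalfSpace 1} (h : x.1 0 = y.1 0) : x = y := by
  apply Subtype.ext
  ext i
  rw [Subsingleton.elim i 0]
  exact h

theorem collarParamInv_left (x : EuclideanHalfSpace 1) : collarParamInv (collarParam x) = x := by
  apply halfSpace_ext
  rw [collarParamInv_coe (collarParam_lt x)]
  have := x.2
  have h0 : 0 < 1 + x.1 0 := by linarith
  change 2 * (x.1 0 / (2 * (1 + x.1 0))) / (1 - 2 * (x.1 0 / (2 * (1 + x.1 0)))) = x.1 0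
  have h1 : (1 - 2 * (x.1 0 / (2 * (1 + x.1 0)))) = 1 / (1 + x.1 0) := by
    field_simp; ring
  rw [h1]
  field_simp

theorem collarParamInv_right {t : Icc (0 : ℝ) 1} (h : (t : ℝ) < 1 / 2) :
    collarParam (collarParamInv t) = t := by
  apply Subtype.ext
  change (collarParamInv t).1 0 / (2 * (1 + (collarParamInv t).1 0)) = t
  rw [collarParamInv_coe h]
  have h0 : 0 < 1 - 2 * (t : ℝ) := by linarith
  have h1 : 1 + 2 * (t : ℝ) / (1 - 2 * t) = 1 / (1 - 2 * t) := by field_simp; ring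
  rw [h1]
  field_simp

theorem contMDiff_halfSpaceCoord :
    ContMDiff (𝓡∂ 1) 𝓘(ℝ, ℝ) ∞ (fun x : EuclideanHalfSpace 1 => x.1 0) :=
  coordOne.contDiff.contMDiff.comp
    (ModelWithCorners.contMDiff (𝓡∂ 1))

theorem contMDiff_collarParam : ContMDiff (𝓡∂ 1) (𝓡∂ 1) ∞ collarParam := by
  have h : ContMDiff (𝓡∂ 1) 𝓘(ℝ, ℝ) ∞ ((fun t : Icc (0 : ℝ) 1 => (t : ℝ)) ∘ collarParam) := by
    intro x
    have := x.2
    have h1 : ContDiffAt ℝ ∞ (fun r : ℝ => r / (2 * (1 + r))) (x.1 0) := by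
      apply ContDiffAt.div (by fun_prop) (by fun_prop)
      positivity
    exact ContMDiffAt.comp (g := fun r : ℝ => r / (2 * (1 + r))) x h1.contMDiffAt
      (contMDiff_halfSpaceCoord x)
  refine contMDiff_iff_comp_subtypeVal_Icc.2 ⟨?_, h⟩
  exact h.continuous.subtype_mk _

theorem contMDiffOn_collarParamInv :
    ContMDiffOn (𝓡∂ 1) (𝓡∂ 1) ∞ collarParamInv {t : Icc (0 : ℝ) 1 | (t : ℝ) < 1 / 2} := by
  have h1 : ContMDiffOn (𝓡∂ 1) 𝓘(ℝ, EuclideanSpace ℝ (Fin 1)) ∞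
      (fun t : Icc (0 : ℝ) 1 =>
        (toLp 2 fun _ => 2 * (t : ℝ) / (1 - 2 * t) : EuclideanSpace ℝ (Fin 1)))
      {t : Icc (0 : ℝ) 1 | (t : ℝ) < 1 / 2} := by
    have h2 : ContDiffOn ℝ ∞ (fun r : ℝ =>
        (toLp 2 fun _ => 2 * r / (1 - 2 * r) : EuclideanSpace ℝ (Fin 1))) {r | r < 1 / 2} := by
      rw [contDiffOn_euclidean]
      intro i
      apply ContDiffOn.div (by fun_prop) (by fun_prop)
      intro r hr
      simp at hr
      intro h; linarith
    exact h2.contMDiffOn.comp contMDiff_subtypeVal_Icc.contMDiffOn (fun t ht => ht)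
  refine (ModelWithCorners.contMDiffOn_symm (𝓡∂ 1)).comp h1 ?_
  intro t ht
  rw [range_modelWithCornersEuclideanHalfSpace]
  have := t.2.1
  simp at ht
  simp
  apply div_nonneg <;> linarith

theorem collarParam_oriented (x : EuclideanHalfSpace 1) :
    OrientedLocalDiffeoAt (𝓡∂ 1) (𝓡∂ 1) (fun _ => 1) intervalOrientation collarParam x := by
  refine ⟨⟨{ toFun := collarParam, invFun := collarParamInv, source := univ,
             target := {t : Icc (0 : ℝ) 1 | (t : ℝ) < 1 / 2},
             map_source' := fun x _ => collarParam_lt x, map_target' := fun _ _ => mem_univ _,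
             left_inv' := fun x _ => collarParamInv_left x,
             right_inv' := fun t ht => collarParamInv_right ht,
             open_source := isOpen_univ,
             open_target := isOpen_lt continuous_subtype_val continuous_const,
             contMDiffOn_toFun := contMDiff_collarParam.contMDiffOn,
             contMDiffOn_invFun := contMDiffOn_collarParamInv }, mem_univ _, fun _ _ => rfl⟩, ?_⟩
  have hc : MDifferentiableAt (𝓡∂ 1) (𝓡∂ 1) collarParam x :=
    (contMDiff_collarParam x).mdifferentiableAt (by simp)
  have h1 := chartDeriv_comp (coe_mdiff (collarParam x)) hc
  have hx := x.2
  have h2 : HasDerivAt (fun r : ℝ => r / (2 * (1 + r))) (1 / (2 * (1 + x.1 0) ^ 2)) (x.1 0) := by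
    have := (hasDerivAt_id (x.1 0)).div (((hasDerivAt_id (x.1 0)).const_add 1).const_mul 2)
      (by simp; positivity)
    convert! this using 1
    simp
    field_simp
    ring
  have hI : MDifferentiableAt (𝓡∂ 1) 𝓘(ℝ, EuclideanSpace ℝ (Fin 1)) (extChartAt (𝓡∂ 1) x) x :=
    mdifferentiableAt_extChartAt (mem_chart_source _ x)
  have h3 : MDifferentiableAt (𝓡∂ 1) 𝓘(ℝ, ℝ) (fun y : EuclideanHalfSpace 1 => y.1 0) x :=
    (contMDiff_halfSpaceCoord x).mdifferentiableAt (by simp)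
  have h2' := h2.hasFDerivAt.hasMFDerivAt
  have h4 := chartDeriv_comp (f := fun y : EuclideanHalfSpace 1 => y.1 0) h2'.mdifferentiableAt h3
  have h2'' : chartDeriv 𝓘(ℝ, ℝ) 𝓘(ℝ, ℝ) (fun r : ℝ => r / (2 * (1 + r))) (x.1 0) = _ := h2'.mfderiv
  have h5 : (fun r : ℝ => r / (2 * (1 + r))) ∘ (fun y : EuclideanHalfSpace 1 => y.1 0) =
    (fun t : Icc (0 : ℝ) 1 => (t : ℝ)) ∘ collarParam := rfl
  rw [h5, h1, h2''] at h4
  have h6 := congrArg (fun A : EuclideanSpace ℝ (Fin 1) →L[ℝ] ℝ => A (EuclideanSpace.single 0 1)) h4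
  have h7 := mfderiv_coord hI (EuclideanSpace.single 0 1)
  rw [chartDeriv_extChartAt_self] at h7
  have h7' : chartDeriv (𝓡∂ 1) 𝓘(ℝ, ℝ) (fun y : EuclideanHalfSpace 1 => y.1 0) x
    (EuclideanSpace.single 0 1) = 1 := h7.trans (by simp)
  have h8 := mfderiv_intervalCoe (collarParam x) ((chartDeriv (𝓡∂ 1) (𝓡∂ 1) collarParam x)
    (EuclideanSpace.single 0 1))
  rw [det_fin_one, one_mul, ← h8]
  refine lt_of_lt_of_eq ?_ h6.symm
  simp only [ContinuousLinearMap.comp_apply]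
  rw [h7']
  simp
  positivity

theorem contMDiff_intervalSymm : ContMDiff (𝓡∂ 1) (𝓡∂ 1) ∞ (unitInterval.symm) := by
  refine contMDiff_iff_comp_subtypeVal_Icc.2 ⟨unitInterval.continuous_symm, ?_⟩
  have h1 : ContDiff ℝ ∞ (fun r : ℝ => 1 - r) := by fun_prop
  exact h1.contMDiff.comp contMDiff_subtypeVal_Icc

theorem intervalSymm_oriented (t : Icc (0 : ℝ) 1) :
    OrientedLocalDiffeoAt (𝓡∂ 1) (𝓡∂ 1) intervalOrientation (fun t => - intervalOrientation t)
      unitInterval.symm t := by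
  refine ⟨({ toEquiv := ⟨unitInterval.symm, unitInterval.symm, unitInterval.symm_symm,
                unitInterval.symm_symm⟩
             contMDiff_toFun := contMDiff_intervalSymm
             contMDiff_invFun := contMDiff_intervalSymm } :
             Diffeomorph (𝓡∂ 1) (𝓡∂ 1) (Icc (0 : ℝ) 1) (Icc (0 : ℝ) 1) ∞).isLocalDiffeomorph t, ?_⟩
  have hc : MDifferentiableAt (𝓡∂ 1) (𝓡∂ 1) unitInterval.symm t :=
    (contMDiff_intervalSymm t).mdifferentiableAt (by simp)
  have h1 := chartDeriv_comp (coe_mdiff (unitInterval.symm t)) hc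
  have h2 : HasMFDerivAt 𝓘(ℝ, ℝ) 𝓘(ℝ, ℝ) (fun r : ℝ => 1 - r) (t : ℝ)
        (-(ContinuousLinearMap.id ℝ ℝ)) :=
      ((hasFDerivAt_id (𝕜 := ℝ) (t : ℝ)).const_sub 1).hasMFDerivAt
  have h3 := chartDeriv_comp h2.mdifferentiableAt (coe_mdiff t)
  have h2' : chartDeriv 𝓘(ℝ, ℝ) 𝓘(ℝ, ℝ) (fun r : ℝ => 1 - r) (t : ℝ) =
      -(ContinuousLinearMap.id ℝ ℝ) := h2.mfderiv
  have h5 : (fun r : ℝ => 1 - r) ∘ (fun y : Icc (0 : ℝ) 1 => (y : ℝ)) =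
    (fun t : Icc (0 : ℝ) 1 => (t : ℝ)) ∘ unitInterval.symm := rfl
  rw [h5, h1, h2'] at h3
  have h6 := congrArg (fun A : EuclideanSpace ℝ (Fin 1) →L[ℝ] ℝ => A (EuclideanSpace.single 0 1)) h3
  have h8 := mfderiv_intervalCoe (unitInterval.symm t)
    ((chartDeriv (𝓡∂ 1) (𝓡∂ 1) unitInterval.symm t) (EuclideanSpace.single 0 1))
  have h9 := mfderiv_intervalCoe t (EuclideanSpace.single 0 1)
  have h10 : ((intervalOrientation (unitInterval.symm t) : ℤ) : ℝ) *
      (chartDeriv (𝓡∂ 1) (𝓡∂ 1) unitInterval.symm t).det =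
     - ((intervalOrientation t : ℤ) : ℝ) := by
    rw [det_fin_one, ← h8]
    refine h6.trans ?_
    change - (chartDeriv (𝓡∂ 1) 𝓘(ℝ, ℝ) (fun t : Icc (0 : ℝ) 1 => (t : ℝ)) t
        (EuclideanSpace.single 0 1)) = _
    rw [h9]; simp
  have h11 : (((intervalOrientation t : ℤ)) : ℝ) * ((intervalOrientation t : ℤ) : ℝ) = 1 := by
    norm_cast; rw [Int.units_mul_self]; simp
  push_cast
  refine lt_of_lt_of_eq (one_pos) ?_
  linear_combination - h11 + (-((intervalOrientation t : ℤ) : ℝ)) * (-1 : ℝ) * h10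
end interval


/-- An oriented bordism from `N₀` to `N₁`: a compact oriented smooth `(p+1)`-manifold `W` with
boundary (modelled on `ℝ^p × [0,∞)`), with an identification of the oriented manifold `∂W` with the
disjoint union of `N₀` and of `N₁` with the opposite orientation.

The identification is given as a collar `(N₀ ⊔ N₁) × [0,∞) → W`, an injective orientation
preserving local diffeomorphism whose restriction to `(N₀ ⊔ N₁) × {0}` is the identification with
`∂W`; every diffeomorphism of `N₀ ⊔ N₁` with `∂W` extends to such a collar by the collar
neighbourhood theorem. `∂W` is oriented by the rule that a basis of its tangent space is positive
when the basis followed by an inward normal vector is positive in `W`; another convention only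
changes the orientation of `W`. -/
structure Bordism {p : ℕ} (N₀ N₁ : CompactOrientedManifold (𝓡 p))
    extends CompactOrientedManifold ((𝓡 p).prod (𝓡∂ 1)) where
  collar₀ : N₀ × EuclideanHalfSpace 1 → carrier
  collar₁ : N₁ × EuclideanHalfSpace 1 → carrier
  oriented₀ : ∀ z, OrientedLocalDiffeoAt ((𝓡 p).prod (𝓡∂ 1)) ((𝓡 p).prod (𝓡∂ 1))
    (fun z : N₀ × EuclideanHalfSpace 1 => N₀.orientation z.1) orientation collar₀ z
  oriented₁ : ∀ z, OrientedLocalDiffeoAt ((𝓡 p).prod (𝓡∂ 1)) ((𝓡 p).prod (𝓡∂ 1))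
    (fun z : N₁ × EuclideanHalfSpace 1 => - N₁.orientation z.1) orientation collar₁ z
  injective : Function.Injective (Sum.elim collar₀ collar₁)
  boundary_eq : ((𝓡 p).prod (𝓡∂ 1)).boundary carrier =
    Set.range (fun x => collar₀ (x, 0)) ∪ Set.range (fun x => collar₁ (x, 0))

namespace Bordism
variable {p : ℕ} {N₀ N₁ N₀' N₁' : CompactOrientedManifold (𝓡 p)}

/-- The identification of `N₀` with a part of `∂W`. -/
def end₀ (W : Bordism N₀ N₁) (x : N₀) : W.carrier := W.collar₀ (x, 0)

/-- The identification of `N₁` with a part of `∂W`. -/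
def end₁ (W : Bordism N₀ N₁) (x : N₁) : W.carrier := W.collar₁ (x, 0)

theorem end₀_mem (W : Bordism N₀ N₁) (x : N₀) :
    W.end₀ x ∈ ((𝓡 p).prod (𝓡∂ 1)).boundary W.carrier := by
  rw [W.boundary_eq]; exact Or.inl ⟨x, rfl⟩

theorem end₁_mem (W : Bordism N₀ N₁) (x : N₁) :
    W.end₁ x ∈ ((𝓡 p).prod (𝓡∂ 1)).boundary W.carrier := by
  rw [W.boundary_eq]; exact Or.inr ⟨x, rfl⟩

/-- `W` with the opposite orientation. -/
noncomputable def neg (W : Bordism N₀ N₁) : Bordism N₀.neg N₁.neg where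
  toCompactOrientedManifold := W.toCompactOrientedManifold.neg
  collar₀ := W.collar₀
  collar₁ := W.collar₁
  oriented₀ z := (W.oriented₀ z).congr_orientation (by simp [CompactOrientedManifold.neg])
  oriented₁ z := (W.oriented₁ z).congr_orientation (by simp [CompactOrientedManifold.neg])
  injective := W.injective
  boundary_eq := W.boundary_eq

/-- The disjoint union of two collars. -/
def sumCollar {A B K V V' : Type*} (c : A × K → V) (c' : B × K → V') (z : (A ⊕ B) × K) : V ⊕ V' :=
  match z with
  | (Sum.inl a, t) => Sum.inl (c (a, t))
  | (Sum.inr b, t) => Sum.inr (c' (b, t))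

theorem sumCollar_injective {A B A' B' K V V' : Type*} {c : A × K → V} {c₁ : A' × K → V}
    {c' : B × K → V'} {c₁' : B' × K → V'} (h : Function.Injective (Sum.elim c c₁))
    (h' : Function.Injective (Sum.elim c' c₁')) :
    Function.Injective (Sum.elim (sumCollar c c') (sumCollar c₁ c₁')) := by
  rintro (⟨a | a, t⟩ | ⟨a | a, t⟩) (⟨b | b, s⟩ | ⟨b | b, s⟩) hab <;>
    simp only [Sum.elim_inl, Sum.elim_inr, sumCollar, Sum.inl.injEq, Sum.inr.injEq,
      reduceCtorEq] at hab
  · have := @h (Sum.inl (a, t)) (Sum.inl (b, s)) hab; simp_all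
  · have := @h (Sum.inl (a, t)) (Sum.inr (b, s)) hab; simp_all
  · have := @h' (Sum.inl (a, t)) (Sum.inl (b, s)) hab; simp_all
  · have := @h' (Sum.inl (a, t)) (Sum.inr (b, s)) hab; simp_all
  · have := @h (Sum.inr (a, t)) (Sum.inl (b, s)) hab; simp_all
  · have := @h (Sum.inr (a, t)) (Sum.inr (b, s)) hab; simp_all
  · have := @h' (Sum.inr (a, t)) (Sum.inl (b, s)) hab; simp_all
  · have := @h' (Sum.inr (a, t)) (Sum.inr (b, s)) hab; simp_all

theorem oriented_of_sum {E E' H H' K : Type*} [NormedAddCommGroup E] [NormedSpace ℝ E]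
    [NormedAddCommGroup E'] [NormedSpace ℝ E'] [FiniteDimensional ℝ E] [FiniteDimensional ℝ E']
    [TopologicalSpace H] [TopologicalSpace H'] [TopologicalSpace K]
    {I : ModelWithCorners ℝ E H} {J : ModelWithCorners ℝ E' K}
    {L : ModelWithCorners ℝ (E × E') H'}
    {A B C V : Type*} [TopologicalSpace A] [ChartedSpace H A] [TopologicalSpace B]
    [ChartedSpace H B] [TopologicalSpace C] [ChartedSpace K C] [TopologicalSpace V]
    [ChartedSpace H' V] {σ : A → ℤˣ} {τ : B → ℤˣ} {υ : V → ℤˣ} {c : (A ⊕ B) × C → V}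
    (hA : ∀ z, OrientedLocalDiffeoAt (I.prod J) L (fun z : A × C => σ z.1) υ
      (fun z : A × C => c (Sum.inl z.1, z.2)) z)
    (hB : ∀ z, OrientedLocalDiffeoAt (I.prod J) L (fun z : B × C => τ z.1) υ
      (fun z : B × C => c (Sum.inr z.1, z.2)) z) (z : (A ⊕ B) × C) :
    OrientedLocalDiffeoAt (I.prod J) L (fun z : (A ⊕ B) × C => Sum.elim σ τ z.1) υ c z := by
  obtain ⟨a | b, t⟩ := z
  · have h1 := (OrientedLocalDiffeoAt.inl (I := I) σ τ a).prodMap (x := (a, t))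
      (OrientedLocalDiffeoAt.id (I := J) (fun _ => 1) t)
    have h2 := h1.of_comp (g := c) (υ := υ) (L := L)
      ((hA (a, t)).congr_orientation (by simp))
    exact h2.congr_orientation (by simp)
  · have h1 := (OrientedLocalDiffeoAt.inr (I := I) σ τ b).prodMap (x := (b, t))
      (OrientedLocalDiffeoAt.id (I := J) (fun _ => 1) t)
    have h2 := h1.of_comp (g := c) (υ := υ) (L := L)
      ((hB (b, t)).congr_orientation (by simp))
    exact h2.congr_orientation (by simp)

/-- The disjoint union of two bordisms. -/
noncomputable def sum (W : Bordism N₀ N₁) (W' : Bordism N₀' N₁') :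
    Bordism (N₀.sum N₀') (N₁.sum N₁') where
  toCompactOrientedManifold := W.toCompactOrientedManifold.sum W'.toCompactOrientedManifold
  collar₀ := sumCollar W.collar₀ W'.collar₀
  collar₁ := sumCollar W.collar₁ W'.collar₁
  oriented₀ := oriented_of_sum
    (fun z => (OrientedLocalDiffeoAt.inl _ _ _).comp (W.oriented₀ z))
    (fun z => (OrientedLocalDiffeoAt.inr _ _ _).comp (W'.oriented₀ z))
  oriented₁ z := (oriented_of_sum (σ := fun x => - N₁.orientation x)
    (τ := fun x => - N₁'.orientation x) (υ := Sum.elim W.orientation W'.orientation)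
    (c := sumCollar W.collar₁ W'.collar₁)
    (fun z => (OrientedLocalDiffeoAt.inl _ _ _).comp (W.oriented₁ z))
    (fun z => (OrientedLocalDiffeoAt.inr _ _ _).comp (W'.oriented₁ z)) z).congr_orientation (by
      obtain ⟨a | b, t⟩ := z <;> rfl)
  injective := sumCollar_injective W.injective W'.injective
  boundary_eq := by
    refine (ModelWithCorners.boundary_disjointUnion).trans ?_
    rw [W.boundary_eq, W'.boundary_eq]
    ext w
    constructor
    · rintro (⟨_, ⟨x, rfl⟩ | ⟨x, rfl⟩, rfl⟩ | ⟨_, ⟨x, rfl⟩ | ⟨x, rfl⟩, rfl⟩)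
      · exact Or.inl ⟨Sum.inl x, rfl⟩
      · exact Or.inr ⟨Sum.inl x, rfl⟩
      · exact Or.inl ⟨Sum.inr x, rfl⟩
      · exact Or.inr ⟨Sum.inr x, rfl⟩
    · rintro (⟨x | x, rfl⟩ | ⟨x | x, rfl⟩)
      · exact Or.inl ⟨_, Or.inl ⟨x, rfl⟩, rfl⟩
      · exact Or.inr ⟨_, Or.inl ⟨x, rfl⟩, rfl⟩
      · exact Or.inl ⟨_, Or.inr ⟨x, rfl⟩, rfl⟩
      · exact Or.inr ⟨_, Or.inr ⟨x, rfl⟩, rfl⟩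

/-- The oriented manifold `N × [0,1]`. -/
noncomputable def cylinderManifold (N : CompactOrientedManifold (𝓡 p)) :
    CompactOrientedManifold ((𝓡 p).prod (𝓡∂ 1)) where
  carrier := N × Set.Icc (0 : ℝ) 1
  orientation z := N.orientation z.1 * intervalOrientation z.2
  isOrientation := by
    have : IsManifold (𝓡 p) 1 N := IsManifold.of_le (n := ∞) (by simp)
    exact N.isOrientation.prod isOrientation_interval

theorem collarParam_zero : collarParam 0 = 0 := by
  apply Subtype.ext
  change (0 : EuclideanSpace ℝ (Fin 1)) 0 / (2 * (1 + (0 : EuclideanSpace ℝ (Fin 1)) 0)) = 0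
  simp

theorem collarParam_injective : Function.Injective collarParam := fun a b h => by
  rw [← collarParamInv_left a, h, collarParamInv_left]

theorem collarParam_ne_symm (a b : EuclideanHalfSpace 1) :
    collarParam a ≠ unitInterval.symm (collarParam b) := by
  intro h
  have h1 := collarParam_lt a
  have h2 := collarParam_lt b
  have h3 : (collarParam a : ℝ) = 1 - collarParam b := congrArg Subtype.val h
  linarith

theorem cylinder_injective {A B : Type*} {d : A → B} (hd : Function.Injective d) :
    Function.Injective (Sum.elim
      (fun z : B × EuclideanHalfSpace 1 => (z.1, collarParam z.2))
      (fun z : A × EuclideanHalfSpace 1 => (d z.1, unitInterval.symm (collarParam z.2)))) := by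
  rintro (⟨a, t⟩ | ⟨a, t⟩) (⟨b, s⟩ | ⟨b, s⟩) hab <;>
    simp only [Sum.elim_inl, Sum.elim_inr, Prod.mk.injEq] at hab
  · rw [hab.1, collarParam_injective hab.2]
  · exact (collarParam_ne_symm _ _ hab.2).elim
  · exact (collarParam_ne_symm _ _ hab.2.symm).elim
  · rw [hd hab.1, collarParam_injective (unitInterval.symm_bijective.1 hab.2)]

/-- The cylinder `N₀ × [0,1]` as a bordism from `N₀` to `N₁`, for an orientation preserving
diffeomorphism `d : N₁ → N₀`. -/
noncomputable def cylinder (N₀ N₁ : CompactOrientedManifold (𝓡 p)) (d : N₁ → N₀)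
    (hd : Function.Bijective d)
    (h : ∀ x, OrientedLocalDiffeoAt (𝓡 p) (𝓡 p) N₁.orientation N₀.orientation d x) :
    Bordism N₀ N₁ where
  toCompactOrientedManifold := cylinderManifold N₀
  collar₀ z := (z.1, collarParam z.2)
  collar₁ z := (d z.1, unitInterval.symm (collarParam z.2))
  oriented₀ z := ((OrientedLocalDiffeoAt.id N₀.orientation z.1).prodMap
    (collarParam_oriented z.2)).congr_orientation (by simp [cylinderManifold])
  oriented₁ z := ((h z.1).prodMap ((intervalSymm_oriented _).comp
    (collarParam_oriented z.2))).congr_orientation (by simp [cylinderManifold])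
  injective := cylinder_injective hd.1
  boundary_eq := by
    refine (boundary_product (𝓡 p)).trans ?_
    ext ⟨n, t⟩
    constructor
    · rintro ⟨-, rfl | rfl⟩
      · exact Or.inl ⟨n, Prod.ext rfl collarParam_zero⟩
      · obtain ⟨m, rfl⟩ := hd.2 n
        refine Or.inr ⟨m, Prod.ext rfl ?_⟩
        simp only [collarParam_zero, unitInterval.symm_zero]; rfl
    · rintro (⟨x, h⟩ | ⟨x, h⟩)
      · refine ⟨trivial, Or.inl ?_⟩
        rw [← congrArg Prod.snd h]; exact collarParam_zero
      · refine ⟨trivial, Or.inr ?_⟩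
        rw [← congrArg Prod.snd h]
        simp only [collarParam_zero, unitInterval.symm_zero]; rfl

/-- Both ends of `N × [0,1]` as one collar. -/
noncomputable def bentCollar (N : Type*) (z : (N ⊕ N) × EuclideanHalfSpace 1) :
    N × Set.Icc (0 : ℝ) 1 :=
  match z with
  | (Sum.inl a, t) => (a, unitInterval.symm (collarParam t))
  | (Sum.inr a, t) => (a, collarParam t)

theorem bentCollar_injective (N : Type*) {f : Empty × EuclideanHalfSpace 1 → N × Set.Icc (0 : ℝ) 1} :
    Function.Injective (Sum.elim (bentCollar N) f) := by
  rintro (⟨a | a, t⟩ | ⟨a, t⟩) (⟨b | b, s⟩ | ⟨b, s⟩) hab <;> (try exact a.elim) <;>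
    (try exact b.elim) <;>
    simp only [Sum.elim_inl, bentCollar, Prod.mk.injEq] at hab
  · rw [hab.1, collarParam_injective (unitInterval.symm_bijective.1 hab.2)]
  · exact (collarParam_ne_symm _ _ hab.2.symm).elim
  · exact (collarParam_ne_symm _ _ hab.2).elim
  · rw [hab.1, collarParam_injective hab.2]

/-- The cylinder `N × [0,1]` as a bordism from `-N ⊔ N` to the empty manifold. -/
noncomputable def bentCylinder (N : CompactOrientedManifold (𝓡 p)) :
    Bordism (N.neg.sum N) CompactOrientedManifold.empty where
  toCompactOrientedManifold := cylinderManifold N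
  collar₀ := bentCollar N
  collar₁ z := z.1.elim
  oriented₀ := oriented_of_sum (c := bentCollar N)
    (fun z => ((OrientedLocalDiffeoAt.id N.orientation z.1).prodMap
      ((intervalSymm_oriented _).comp (collarParam_oriented z.2))).congr_orientation
        (by simp [cylinderManifold, CompactOrientedManifold.neg]))
    (fun z => ((OrientedLocalDiffeoAt.id N.orientation z.1).prodMap
      (collarParam_oriented z.2)).congr_orientation (by simp [cylinderManifold]))
  oriented₁ z := z.1.elim
  injective := bentCollar_injective N
  boundary_eq := by
    refine (boundary_product (𝓡 p)).trans ?_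
    ext ⟨n, t⟩
    constructor
    · rintro ⟨-, rfl | rfl⟩
      · exact Or.inl ⟨Sum.inr n, Prod.ext rfl collarParam_zero⟩
      · refine Or.inl ⟨Sum.inl n, Prod.ext rfl ?_⟩
        simp only [bentCollar, collarParam_zero, unitInterval.symm_zero]; rfl
    · rintro (⟨x | x, h⟩ | ⟨x, h⟩)
      · refine ⟨trivial, Or.inr ?_⟩
        rw [← congrArg Prod.snd h]
        simp only [bentCollar, collarParam_zero, unitInterval.symm_zero]; rfl
      · refine ⟨trivial, Or.inl ?_⟩
        rw [← congrArg Prod.snd h]; exact collarParam_zero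
      · exact x.elim
end Bordism

universe u v w

/-- A singular closed oriented smooth `p`-manifold in `A`: a closed oriented `p`-manifold with a
continuous map to `A`. The manifolds live in `Type`; every compact manifold is diffeomorphic to
one that does. -/
structure SingularClosedManifold (p : ℕ) (A : Type*) [TopologicalSpace A]
    extends CompactOrientedManifold (𝓡 p) where
  map : C(carrier, A)

namespace SingularClosedManifold
variable {p : ℕ} {A B : Type*} [TopologicalSpace A] [TopologicalSpace B]

/-- `[s] ↦ [e ∘ s]`. -/
def push (e : C(A, B)) (s : SingularClosedManifold p A) : SingularClosedManifold p B where
  toCompactOrientedManifold := s.toCompactOrientedManifold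
  map := e.comp s.map

/-- The opposite orientation. -/
noncomputable def neg (s : SingularClosedManifold p A) : SingularClosedManifold p A where
  toCompactOrientedManifold := s.toCompactOrientedManifold.neg
  map := s.map

/-- The disjoint union. -/
noncomputable def sum (s t : SingularClosedManifold p A) : SingularClosedManifold p A where
  toCompactOrientedManifold := s.toCompactOrientedManifold.sum t.toCompactOrientedManifold
  map := ⟨Sum.elim s.map t.map, s.map.continuous.sumElim t.map.continuous⟩

/-- The empty singular manifold. -/
noncomputable def empty : SingularClosedManifold p A where
  toCompactOrientedManifold := CompactOrientedManifold.empty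
  map := ⟨fun x : Empty => x.elim, continuous_iff_continuousAt.2 fun x : Empty => x.elim⟩

theorem push_sum (e : C(A, B)) (s t : SingularClosedManifold p A) :
    (s.sum t).push e = (s.push e).sum (t.push e) := by
  have : e.comp (s.sum t).map = ((s.push e).sum (t.push e)).map := by
    ext (x | x) <;> rfl
  unfold push sum at *
  simp only [SingularClosedManifold.mk.injEq, heq_eq_eq, true_and]
  exact this

theorem push_empty (e : C(A, B)) :
    (empty : SingularClosedManifold p A).push e = empty := by
  have : e.comp (empty : SingularClosedManifold p A).map =
      (empty : SingularClosedManifold p B).map := by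
    ext x; exact x.elim
  unfold push empty at *
  simp only [SingularClosedManifold.mk.injEq, heq_eq_eq, true_and]
  exact this

end SingularClosedManifold

/-- `s₀` and `s₁` are bordant in `A`. -/
def Bordant {p : ℕ} {A : Type*} [TopologicalSpace A] (s₀ s₁ : SingularClosedManifold p A) : Prop :=
  ∃ (W : Bordism s₀.toCompactOrientedManifold s₁.toCompactOrientedManifold) (h : C(W.carrier, A)),
    (∀ x, h (W.end₀ x) = s₀.map x) ∧ (∀ x, h (W.end₁ x) = s₁.map x)

/-- Four properties of a relation between singular manifolds which make the disjoint union a group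
structure on its classes (proved for bordism and for Nielsen equivalence below). -/
structure IsAdditiveRelation {p : ℕ} {A : Type*} [TopologicalSpace A]
    (r : SingularClosedManifold p A → SingularClosedManifold p A → Prop) : Prop where
  of_diffeo : ∀ (s t : SingularClosedManifold p A) (d : t.carrier → s.carrier), d.Bijective →
    (∀ x, OrientedLocalDiffeoAt (𝓡 p) (𝓡 p) t.orientation s.orientation d x) →
    (∀ x, s.map (d x) = t.map x) → r s t
  sum : ∀ {s s' t t' : SingularClosedManifold p A}, r s s' → r t t' → r (s.sum t) (s'.sum t')
  neg : ∀ {s s' : SingularClosedManifold p A}, r s s' → r s.neg s'.neg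
  neg_sum : ∀ s : SingularClosedManifold p A, r (s.neg.sum s) SingularClosedManifold.empty

namespace IsAdditiveRelation
variable {p : ℕ} {A B : Type*} [TopologicalSpace A] [TopologicalSpace B]

theorem bordant : IsAdditiveRelation (Bordant (p := p) (A := A)) where
  of_diffeo s t d hd hd' h := by
    refine ⟨Bordism.cylinder _ _ d hd hd', s.map.comp ⟨Prod.fst, continuous_fst⟩, fun x => rfl, h⟩
  sum := by
    rintro s s' t t' ⟨W, h, h₀, h₁⟩ ⟨W', h', h₀', h₁'⟩
    refine ⟨W.sum W', ⟨Sum.elim h h', h.continuous.sumElim h'.continuous⟩, ?_, ?_⟩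
    · rintro (x | x)
      · exact h₀ x
      · exact h₀' x
    · rintro (x | x)
      · exact h₁ x
      · exact h₁' x
  neg := by
    rintro s s' ⟨W, h, h₀, h₁⟩
    exact ⟨W.neg, h, h₀, h₁⟩
  neg_sum s := by
    refine ⟨Bordism.bentCylinder _, s.map.comp ⟨Prod.fst, continuous_fst⟩, ?_, fun x => x.elim⟩
    rintro (x | x) <;> rfl

theorem comap (e : C(A, B)) {r : SingularClosedManifold p B → SingularClosedManifold p B → Prop}
    (hr : IsAdditiveRelation r) : IsAdditiveRelation fun s t => r (s.push e) (t.push e) where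
  of_diffeo s t d hd hd' h := hr.of_diffeo _ _ d hd hd' fun x => congrArg e (h x)
  sum h h' := by
    rw [SingularClosedManifold.push_sum, SingularClosedManifold.push_sum]; exact hr.sum h h'
  neg h := hr.neg h
  neg_sum s := by
    rw [SingularClosedManifold.push_sum, SingularClosedManifold.push_empty]; exact hr.neg_sum (s.push e)

variable {r : SingularClosedManifold p A → SingularClosedManifold p A → Prop}

theorem refl (hr : IsAdditiveRelation r) (s : SingularClosedManifold p A) : r s s :=
  hr.of_diffeo s s (fun x => x) Function.bijective_id (OrientedLocalDiffeoAt.id _) fun _ => rfl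

theorem comm (hr : IsAdditiveRelation r) (s t : SingularClosedManifold p A) :
    r (s.sum t) (t.sum s) := by
  refine hr.of_diffeo _ _ (Sum.swap : t.carrier ⊕ s.carrier → s.carrier ⊕ t.carrier)
    (Equiv.sumComm _ _).bijective ?_ ?_
  · rintro (x | x)
    · exact (OrientedLocalDiffeoAt.inl t.orientation s.orientation x).of_comp
        (OrientedLocalDiffeoAt.inr s.orientation t.orientation x)
    · exact (OrientedLocalDiffeoAt.inr t.orientation s.orientation x).of_comp
        (OrientedLocalDiffeoAt.inl s.orientation t.orientation x)
  · rintro (x | x) <;> rfl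

theorem assoc (hr : IsAdditiveRelation r) (s t w : SingularClosedManifold p A) :
    r ((s.sum t).sum w) (s.sum (t.sum w)) := by
  refine hr.of_diffeo _ _ ((Equiv.sumAssoc s.carrier t.carrier w.carrier).symm)
    (Equiv.sumAssoc _ _ _).symm.bijective ?_ ?_
  · rintro (x | x | x)
    · exact (OrientedLocalDiffeoAt.inl s.orientation (t.sum w).orientation x).of_comp
        ((OrientedLocalDiffeoAt.inl (s.sum t).orientation w.orientation _).comp
          (OrientedLocalDiffeoAt.inl s.orientation t.orientation x))
    · exact ((OrientedLocalDiffeoAt.inr s.orientation (t.sum w).orientation _).comp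
          (OrientedLocalDiffeoAt.inl t.orientation w.orientation x)).of_comp
        ((OrientedLocalDiffeoAt.inl (s.sum t).orientation w.orientation _).comp
          (OrientedLocalDiffeoAt.inr s.orientation t.orientation x))
    · exact ((OrientedLocalDiffeoAt.inr s.orientation (t.sum w).orientation _).comp
          (OrientedLocalDiffeoAt.inr t.orientation w.orientation x)).of_comp
        (OrientedLocalDiffeoAt.inr (s.sum t).orientation w.orientation x)
  · rintro (x | x | x) <;> rfl

theorem empty_sum (hr : IsAdditiveRelation r) (s : SingularClosedManifold p A) :
    r (SingularClosedManifold.empty.sum s) s := by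
  refine hr.of_diffeo _ _ (Sum.inr : s.carrier → Empty ⊕ s.carrier)
    ⟨Sum.inr_injective, ?_⟩ ?_ fun _ => rfl
  · rintro (x | x)
    · exact x.elim
    · exact ⟨x, rfl⟩
  · exact fun x => OrientedLocalDiffeoAt.inr _ s.orientation x

/-- The group structure given by the disjoint union; the zero is the empty manifold and the
negative is the opposite orientation. -/
@[reducible]
noncomputable def addCommGroup (hr : IsAdditiveRelation r) : AddCommGroup (Quot r) :=
  letI : Add (Quot r) := ⟨Quot.map₂ SingularClosedManifold.sum (fun s _ _ h => hr.sum (hr.refl s) h)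
    (fun _ _ t h => hr.sum h (hr.refl t))⟩
  letI : Zero (Quot r) := ⟨Quot.mk r SingularClosedManifold.empty⟩
  letI : Neg (Quot r) := ⟨Quot.map SingularClosedManifold.neg fun _ _ h => hr.neg h⟩
  { add_assoc := by
      rintro ⟨a⟩ ⟨b⟩ ⟨c⟩; exact Quot.sound (hr.assoc a b c)
    zero_add := by rintro ⟨a⟩; exact Quot.sound (hr.empty_sum a)
    add_zero := by
      rintro ⟨a⟩
      exact (Quot.sound (hr.comm a SingularClosedManifold.empty)).trans
        (Quot.sound (hr.empty_sum a))
    nsmul := nsmulRec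
    zsmul := zsmulRec
    neg_add_cancel := by rintro ⟨a⟩; exact Quot.sound (hr.neg_sum a)
    add_comm := by rintro ⟨a⟩ ⟨b⟩; exact Quot.sound (hr.comm a b) }

end IsAdditiveRelation

/-- The oriented bordism group `Ω_p(A)`. (`Quot` is the quotient by the equivalence relation that
the relation generates; bordism is an equivalence relation.) -/
def BordismGroup (p : ℕ) (A : Type u) [TopologicalSpace A] : Type (max u 1) :=
  Quot (Bordant (p := p) (A := A))

noncomputable instance (p : ℕ) (A : Type u) [TopologicalSpace A] :
    AddCommGroup (BordismGroup p A) :=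
  IsAdditiveRelation.bordant.addCommGroup

section Nielsen
variable {X : Type u} {U : Type v} {Z : Type w} [TopologicalSpace X] [TopologicalSpace U]
  [TopologicalSpace Z] {p : ℕ}

/-- Nielsen equivalence of `s₀, s₁` in `C = f⁻¹(Y)`: there is a bordism `W` from `S₀` to `S₁` with an
extension `H : W → X` of `s₀ ⊔ s₁` and an extension `G : W → Y` of `f s₀ ⊔ f s₁` such that `f H` and
`G` are homotopic as maps to `Z` relative to the boundary `S₀ ⊔ S₁`. -/
def NielsenEquiv (f : C(X, Z)) (Y : Set Z) (s₀ s₁ : SingularClosedManifold p (f ⁻¹' Y)) : Prop :=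
  ∃ (W : Bordism s₀.toCompactOrientedManifold s₁.toCompactOrientedManifold)
    (H : C(W.carrier, X)) (G : C(W.carrier, Y)),
    (∀ x, H (W.end₀ x) = s₀.map x) ∧ (∀ x, H (W.end₁ x) = s₁.map x) ∧
    (∀ x, (G (W.end₀ x) : Z) = f (s₀.map x)) ∧ (∀ x, (G (W.end₁ x) : Z) = f (s₁.map x)) ∧
    (f.comp H).HomotopicRel ((ContinuousMap.mk Subtype.val).comp G)
      (((𝓡 p).prod (𝓡∂ 1)).boundary W.carrier)

/-- The triples of a point `x` of `X`, a path in `Z` and a point `y` of `Y` such that the path leads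
from `f x` to `y`. Nielsen equivalence is bordism in this space. -/
def HomotopyFiber (f : C(X, Z)) (Y : Set Z) : Type (max u w) :=
  {q : X × C(unitInterval, Z) × Y // q.2.1 0 = f q.1 ∧ q.2.1 1 = q.2.2}

instance (f : C(X, Z)) (Y : Set Z) : TopologicalSpace (HomotopyFiber f Y) :=
  inferInstanceAs (TopologicalSpace (Subtype _))

/-- `x ↦ (x, constant path, f x)`. -/
def toHomotopyFiber (f : C(X, Z)) (Y : Set Z) : C(f ⁻¹' Y, HomotopyFiber f Y) where
  toFun x := ⟨(x, ContinuousMap.const _ (f x), ⟨f x, x.2⟩), rfl, rfl⟩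
  continuous_toFun := by
    refine Continuous.subtype_mk (continuous_subtype_val.prodMk (Continuous.prodMk ?_ ?_)) _
    · exact ContinuousMap.continuous_const'.comp (f.continuous.comp continuous_subtype_val)
    · exact (f.continuous.comp continuous_subtype_val).subtype_mk _

theorem nielsenEquiv_iff (f : C(X, Z)) (Y : Set Z) (s₀ s₁ : SingularClosedManifold p (f ⁻¹' Y)) :
    NielsenEquiv f Y s₀ s₁ ↔
      Bordant (s₀.push (toHomotopyFiber f Y)) (s₁.push (toHomotopyFiber f Y)) := by
  constructor
  · rintro ⟨W, H, G, hH₀, hH₁, hG₀, hG₁, ⟨K⟩⟩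
    let γ : C(W.carrier, C(unitInterval, Z)) :=
      (K.toContinuousMap.comp ContinuousMap.prodSwap).curry
    have hγ : ∀ w, w ∈ ((𝓡 p).prod (𝓡∂ 1)).boundary W.carrier →
        γ w = ContinuousMap.const _ (f (H w)) := by
      intro w hw
      ext t
      exact K.eq_fst t hw
    refine ⟨W, ⟨fun w => ⟨(H w, γ w, G w), K.map_zero_left w, K.map_one_left w⟩, ?_⟩, ?_, ?_⟩
    · exact Continuous.subtype_mk
        (H.continuous.prodMk (γ.continuous.prodMk G.continuous)) _
    · intro x
      refine Subtype.ext (Prod.ext (hH₀ x) (Prod.ext ?_ (Subtype.ext (hG₀ x))))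
      refine (hγ _ (W.end₀_mem x)).trans ?_
      exact congrArg (fun y => ContinuousMap.const unitInterval (f y)) (hH₀ x)
    · intro x
      refine Subtype.ext (Prod.ext (hH₁ x) (Prod.ext ?_ (Subtype.ext (hG₁ x))))
      refine (hγ _ (W.end₁_mem x)).trans ?_
      exact congrArg (fun y => ContinuousMap.const unitInterval (f y)) (hH₁ x)
  · rintro ⟨W, h, h₀, h₁⟩
    have hc : Continuous fun w => (h w).1 := continuous_subtype_val.comp h.continuous
    have hγ : Continuous fun w => (h w).1.2.1 := (continuous_fst.comp continuous_snd).comp hc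
    refine ⟨W, ⟨fun w => (h w).1.1, continuous_fst.comp hc⟩,
      ⟨fun w => (h w).1.2.2, (continuous_snd.comp continuous_snd).comp hc⟩,
      fun x => congrArg (fun q => q.1.1) (h₀ x), fun x => congrArg (fun q => q.1.1) (h₁ x),
      fun x => congrArg (fun q => (q.1.2.2 : Z)) (h₀ x),
      fun x => congrArg (fun q => (q.1.2.2 : Z)) (h₁ x), ⟨?_⟩⟩
    refine
      { toFun := fun z => (h z.2).1.2.1 z.1
        continuous_toFun := ContinuousEval.continuous_eval.comp
          ((hγ.comp continuous_snd).prodMk continuous_fst)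
        map_zero_left := fun w => (h w).2.1
        map_one_left := fun w => (h w).2.2
        prop' := ?_ }
    intro t w hw
    rw [W.boundary_eq] at hw
    rcases hw with ⟨x, rfl⟩ | ⟨x, rfl⟩
    · change (h (W.end₀ x)).1.2.1 t = f (h (W.end₀ x)).1.1
      rw [h₀ x]; rfl
    · change (h (W.end₁ x)).1.2.1 t = f (h (W.end₁ x)).1.1
      rw [h₁ x]; rfl

theorem isAdditiveRelation_nielsenEquiv (f : C(X, Z)) (Y : Set Z) :
    IsAdditiveRelation (NielsenEquiv (p := p) f Y) := by
  have h := (IsAdditiveRelation.bordant (p := p)).comap (toHomotopyFiber f Y)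
  have he : NielsenEquiv (p := p) f Y = fun s t =>
      Bordant (s.push (toHomotopyFiber f Y)) (t.push (toHomotopyFiber f Y)) := by
    ext s t; exact nielsenEquiv_iff f Y s t
  rw [he]; exact h

/-- The group `S'_p(f, Y)` of Nielsen classes of singular closed oriented `p`-manifolds in `f⁻¹(Y)`.
(`Quot` is the quotient by the equivalence relation that the relation generates; Nielsen equivalence
is an equivalence relation.) -/
def PreNielsenGroup (f : C(X, Z)) (Y : Set Z) (p : ℕ) : Type (max u 1) :=
  Quot (NielsenEquiv (p := p) f Y)

noncomputable instance (f : C(X, Z)) (Y : Set Z) (p : ℕ) : AddCommGroup (PreNielsenGroup f Y p) :=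
  (isAdditiveRelation_nielsenEquiv f Y).addCommGroup

/-- The Nielsen class of a singular manifold. -/
def nielsenClass {f : C(X, Z)} {Y : Set Z} (s : SingularClosedManifold p (f ⁻¹' Y)) :
    PreNielsenGroup f Y p :=
  Quot.mk _ s

/-- The map `f⁻¹(Y) → g⁻¹(Y)` given by `k` with `g k = f`. -/
def preimageMap {f : C(X, Z)} {g : C(U, Z)} (k : C(X, U)) (hk : g.comp k = f) (Y : Set Z) :
    C(f ⁻¹' Y, g ⁻¹' Y) where
  toFun x := ⟨k x.1, (congrArg (· ∈ Y) (DFunLike.congr_fun hk x.1)).mpr x.2⟩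
  continuous_toFun := (k.continuous.comp continuous_subtype_val).subtype_mk _

/-- `k'_* : S'_p(f, Y) → S'_p(g, Y)`, `[s] ↦ [k s]`, for `g k = f`. -/
noncomputable def inducedHom {f : C(X, Z)} {g : C(U, Z)} (k : C(X, U)) (hk : g.comp k = f)
    (Y : Set Z) (p : ℕ) : PreNielsenGroup f Y p →+ PreNielsenGroup g Y p where
  toFun := Quot.map (SingularClosedManifold.push (preimageMap k hk Y)) (by
    subst hk
    rintro s t ⟨W, H, G, hH₀, hH₁, hG₀, hG₁, hK⟩
    exact ⟨W, k.comp H, G, fun x => congrArg k (hH₀ x), fun x => congrArg k (hH₁ x),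
      hG₀, hG₁, hK⟩)
  map_zero' := congrArg (Quot.mk _) (SingularClosedManifold.push_empty _)
  map_add' := by
    rintro ⟨s⟩ ⟨t⟩
    exact congrArg (Quot.mk _) (SingularClosedManifold.push_sum _ _ _)

/-- The inclusion `i_t : X → [0,1] × X`, `x ↦ (t, x)`. -/
def slice (X : Type u) [TopologicalSpace X] (t : unitInterval) : C(X, unitInterval × X) where
  toFun x := (t, x)

/-- The Nielsen group `S_p(f, Y)`, as a subgroup of `S'_p(f, Y)`: the intersection, over all
homotopies `F : [0,1] × X → Z` of `f`, of the groups of classes that are preserved by `F`, which are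
the classes `z` whose image `i_0'(z)` in `S'_p(F, Y)` lies in the image of
`i_1' : S'_p(F_1, Y) → S'_p(F, Y)`. -/
noncomputable def nielsenSubgroup (f : C(X, Z)) (Y : Set Z) (p : ℕ) :
    AddSubgroup (PreNielsenGroup f Y p) :=
  ⨅ (F : C(unitInterval × X, Z)) (hF : F.comp (slice X 0) = f),
    (inducedHom (slice X 1) rfl Y p : PreNielsenGroup (F.comp (slice X 1)) Y p →+
      PreNielsenGroup F Y p).range.comap (inducedHom (slice X 0) hF Y p)

/-- `f : f⁻¹(Y) → Y`. -/
def restrictToPreimage (f : C(X, Z)) (Y : Set Z) : C(f ⁻¹' Y, Y) where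
  toFun x := ⟨f x, x.2⟩
  continuous_toFun := (f.continuous.comp continuous_subtype_val).subtype_mk _

/-- The index `I_f : S'_p(f, Y) → Ω_p(Y)`, `[s] ↦ [f s]`. -/
noncomputable def bordismIndex (f : C(X, Z)) (Y : Set Z) (p : ℕ) :
    PreNielsenGroup f Y p →+ BordismGroup p Y where
  toFun := Quot.map (SingularClosedManifold.push (restrictToPreimage f Y)) (by
    rintro s t ⟨W, H, G, -, -, hG₀, hG₁, -⟩
    exact ⟨W, G, fun x => Subtype.ext (hG₀ x), fun x => Subtype.ext (hG₁ x)⟩)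
  map_zero' := congrArg (Quot.mk _) (SingularClosedManifold.push_empty _)
  map_add' := by
    rintro ⟨s⟩ ⟨t⟩
    exact congrArg (Quot.mk _) (SingularClosedManifold.push_sum _ _ _)

/-- `S^a_p(f, Y) = S'_p(f, Y) / ker I_f`. -/
abbrev AlgNielsenGroup (f : C(X, Z)) (Y : Set Z) (p : ℕ) : Type (max u 1) :=
  PreNielsenGroup f Y p ⧸ (bordismIndex f Y p).ker

end Nielsen


section Category
open CategoryTheory

/-- The map `f : X → Z` of an object of `Over Z`. For `Y ⊆ Z` the category of preimage problems
`P(Z, Y)` is `Over Z`: its objects are the maps `f : X → Z` and its morphisms from `f : X → Z` to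
`g : U → Z` are the maps `k : X → U` with `g k = f`. -/
abbrev problemMap {Z : TopCat.{u}} (P : Over Z) : C(P.left, Z) := P.hom.hom

/-- The map `k : X → U` of a morphism of preimage problems. -/
abbrev morphismMap {Z : TopCat.{u}} {P Q : Over Z} (k : P ⟶ Q) : C(P.left, Q.left) := k.left.hom

theorem problemMap_comp {Z : TopCat.{u}} {P Q : Over Z} (k : P ⟶ Q) :
    (problemMap Q).comp (morphismMap k) = problemMap P :=
  congrArg (fun φ : P.left ⟶ Z => φ.hom) (Over.w k)

/-- The graded abelian group `S'_*(f, Y)`. -/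
noncomputable def preNielsenObj {Z : TopCat.{u}} (Y : Set Z) (P : Over Z) :
    GradedObject ℕ AddCommGrpCat.{max u 1} :=
  fun p => AddCommGrpCat.of (PreNielsenGroup (problemMap P) Y p)

/-- The graded abelian group `S_*(f, Y)`. -/
noncomputable def nielsenObj {Z : TopCat.{u}} (Y : Set Z) (P : Over Z) :
    GradedObject ℕ AddCommGrpCat.{max u 1} :=
  fun p => AddCommGrpCat.of (nielsenSubgroup (problemMap P) Y p)

/-- The graded abelian group `S^a_*(f, Y)`. -/
noncomputable def algNielsenObj {Z : TopCat.{u}} (Y : Set Z) (P : Over Z) :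
    GradedObject ℕ AddCommGrpCat.{max u 1} :=
  fun p => AddCommGrpCat.of (AlgNielsenGroup (problemMap P) Y p)

/-- A functor with prescribed values on objects. -/
structure FunctorOn {C D : Type*} [Category* C] [Category* D] (F : C → D) where
  map : ∀ {P Q : C}, (P ⟶ Q) → (F P ⟶ F Q)
  map_id : ∀ P : C, map (𝟙 P) = 𝟙 (F P)
  map_comp : ∀ {P Q R : C} (k : P ⟶ Q) (l : Q ⟶ R), map (k ≫ l) = map k ≫ map l

/-- The functor as a Mathlib functor. -/
def FunctorOn.toFunctor {C D : Type*} [Category* C] [Category* D] {F : C → D} (S : FunctorOn F) :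
    C ⥤ D where
  obj := F
  map := S.map
  map_id := S.map_id
  map_comp := S.map_comp

end Category

end HigherNielsen

open CategoryTheory HigherNielsen
universe u

/-! A Nielsen class is a bordism class in the homotopy fibre `E(f)` of triples (point `x` of `X`,
path from `f x` to `y`, point `y` of `Y`), into which `f⁻¹(Y)` is mapped by constant paths.
Functoriality is formal. Composition with `k` preserves Nielsen equivalence; a homotopy of `g` pulls
back along `id × k` to a homotopy of `f = g k`, so classes preserved by all homotopies go to such
classes; and `g k s = f s`, so kernels of the index go to kernels.

The content is (b). The groups `S'` are not homotopy invariant, since `k'_*` need not be surjective: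
for `g = id : ℝ → ℝ`, `Y = {0}` and `X = {1}` the preimage in `X` is empty. Preservation under
homotopies supplies the missing classes (`exists_mem_nielsenSubgroup_of_homotopy`). Let `K` be a
homotopy from `id_U` to `m` and let `w ∈ S_p(g)`. Then `g K` is a homotopy from `g` to `g m`, so
`i_0 w = i_1 v` for some `v ∈ S'_p(g m)`, and the morphism `K : (I × U, g K) → (U, g)` turns this
into `w = m_* v`. Moreover `v ∈ S_p(g m)`: a homotopy `H` of `g m` is appended to `g K`, the class
`w` survives the concatenation, and the inclusion of the half that carries `H` induces an injection.

Let `l` be a homotopy inverse of `k`. Surjectivity of `k_*` is the case `m = k l`. For injectivity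
let `k_* z = 0` and write `z = (l k)_* v`. Then `(k l)_* (k_* v) = k_* z = 0`. A self map homotopic
to the identity is injective on `S'`, so `k_* v = 0` and `z = l_* (k_* v) = 0`. No compatibility
between the homotopies `k l ≃ id` and `l k ≃ id` is needed.

Both injectivity statements come from `inducedHom_injective_of_retract`: a homotopy `M` from `k l`
to `id` gives a map `E(g) → E(g k)` that precedes a path by `g M`, and a bordism in `E(g)` is pushed
along it. This requires that equal classes be joined by an actual bordism, hence that bordism be
transitive. The gluing of bordisms removes the common ends and identifies two open collars by `t ↦ 1
- t`; the transition maps are then the identity or this flip, so no smoothing is involved. -/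

namespace HigherNielsen

/-! ### Oriented local diffeomorphisms depend only on germs -/

section congr
variable {E H H' : Type*} [NormedAddCommGroup E] [NormedSpace ℝ E]
  [TopologicalSpace H] [TopologicalSpace H']
  {I : ModelWithCorners ℝ E H} {J : ModelWithCorners ℝ E H'}
  {M N : Type*} [TopologicalSpace M] [ChartedSpace H M] [TopologicalSpace N] [ChartedSpace H' N]

/-- The restriction of a partial diffeomorphism to an open subset. -/
noncomputable def PartialDiffeomorph.restrOpen (Φ : PartialDiffeomorph I J M N ∞) (s : Set M) (hs : IsOpen s) :
    PartialDiffeomorph I J M N ∞ where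
  toPartialEquiv := (Φ.toOpenPartialHomeomorph.restrOpen s hs).toPartialEquiv
  open_source := (Φ.toOpenPartialHomeomorph.restrOpen s hs).open_source
  open_target := (Φ.toOpenPartialHomeomorph.restrOpen s hs).open_target
  contMDiffOn_toFun := Φ.contMDiffOn_toFun.mono Set.inter_subset_left
  contMDiffOn_invFun := Φ.contMDiffOn_invFun.mono Set.inter_subset_left

theorem OrientedLocalDiffeoAt.congr_of_eventuallyEq {σ : M → ℤˣ} {τ : N → ℤˣ} {f g : M → N} {x : M}
    (hf : OrientedLocalDiffeoAt I J σ τ f x) (h : g =ᶠ[𝓝 x] f) :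
    OrientedLocalDiffeoAt I J σ τ g x := by
  have hd : chartDeriv I J g x = chartDeriv I J f x := h.mfderiv_eq
  refine ⟨?_, ?_⟩
  · obtain ⟨Φ, hx, he⟩ := hf.1
    obtain ⟨s, hs, hso, hxs⟩ := eventually_nhds_iff.1 h
    refine ⟨PartialDiffeomorph.restrOpen Φ s hso, ⟨hx, hxs⟩, ?_⟩
    rintro y ⟨hy, hys⟩
    exact (hs y hys).trans (he hy)
  · rw [hd, h.eq_of_nhds]
    exact hf.2

theorem OrientedLocalDiffeoAt.continuousAt {σ : M → ℤˣ} {τ : N → ℤˣ} {f : M → N} {x : M}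
    (hf : OrientedLocalDiffeoAt I J σ τ f x) : ContinuousAt f x :=
  hf.1.contMDiffAt.continuousAt

end congr

/-! ### Manifold structures from oriented parametrisations -/

/-- A family of partial homeomorphisms from an oriented manifold `V` to a space `Q`, whose
targets cover `Q` and whose transition maps are oriented local diffeomorphisms. -/
structure OrientedCover {E H V : Type*} [NormedAddCommGroup E] [NormedSpace ℝ E]
    [TopologicalSpace H] (I : ModelWithCorners ℝ E H) [TopologicalSpace V] [ChartedSpace H V]
    (σ : V → ℤˣ) (Q : Type*) [TopologicalSpace Q] where
  param : Q → OpenPartialHomeomorph V Q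
  mem_target : ∀ q, q ∈ (param q).target
  transition : ∀ q q' : Q, ∀ m ∈ (param q).source, param q m ∈ (param q').target →
    OrientedLocalDiffeoAt I I σ σ ((param q').symm ∘ param q) m

namespace OrientedCover
variable {E H V : Type*} [NormedAddCommGroup E] [NormedSpace ℝ E]
  [TopologicalSpace H] {I : ModelWithCorners ℝ E H} [TopologicalSpace V] [ChartedSpace H V]
  {σ : V → ℤˣ} {Q : Type*} [TopologicalSpace Q] (C : OrientedCover I σ Q)

/-- The point of `V` that represents `q`. -/
def rep (q : Q) : V := (C.param q).symm q

theorem rep_mem (q : Q) : C.rep q ∈ (C.param q).source := (C.param q).map_target (C.mem_target q)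

theorem param_rep (q : Q) : C.param q (C.rep q) = q := (C.param q).right_inv (C.mem_target q)

/-- The charts of `V` carried over to `Q`. -/
@[reducible]
def chartedSpace : ChartedSpace H Q where
  atlas := Set.range fun q => (C.param q).symm ≫ₕ chartAt H (C.rep q)
  chartAt q := (C.param q).symm ≫ₕ chartAt H (C.rep q)
  mem_chart_source q := by
    rw [OpenPartialHomeomorph.trans_source]
    exact ⟨C.mem_target q, mem_chart_source H (C.rep q)⟩
  chart_mem_atlas q := ⟨q, rfl⟩

/-- A coordinate change is a transition map read in the charts of `V` at the two representatives.
These need not be the preferred charts at the point in question, but smoothness at a point of `V`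
may be tested in any chart around it. -/
theorem isManifold [IsManifold I ∞ V] :
    letI := C.chartedSpace
    IsManifold I ∞ Q := by
  let _ := C.chartedSpace
  apply isManifold_of_contDiffOn
  rintro _ _ ⟨q, rfl⟩ ⟨q', rfl⟩
  rintro y ⟨hy, hyr⟩
  simp only [Set.mem_preimage, OpenPartialHomeomorph.trans_source,
    OpenPartialHomeomorph.symm_source, OpenPartialHomeomorph.trans_symm_eq_symm_trans_symm,
    OpenPartialHomeomorph.symm_symm, OpenPartialHomeomorph.coe_trans, Set.mem_inter_iff,
    Function.comp] at hy
  obtain ⟨⟨hy1, hy2⟩, hy3, hy4⟩ := hy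
  set m := (chartAt H (C.rep q)).symm (I.symm y) with hm
  have ht := (C.transition q q' m hy2 hy3).1.contMDiffAt
  have hms : m ∈ (chartAt H (C.rep q)).source := (chartAt H (C.rep q)).map_target hy1
  have h2 := ((contMDiffAt_iff_of_mem_source hms hy4).1 ht).2
  have he : extChartAt I (C.rep q) m = y := by
    rw [extChartAt_coe, Function.comp, hm, (chartAt H (C.rep q)).right_inv hy1, I.right_inv hyr]
  rw [he] at h2
  exact h2.mono Set.inter_subset_right

theorem extChartAt_eq (q : Q) :
    letI := C.chartedSpace
    (extChartAt I q : Q → E) = extChartAt I (C.rep q) ∘ (C.param q).symm := rfl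

/-- The chart at `q` takes `q` to the point of the model to which the chart at `rep q` takes `rep
q`. -/
theorem mem_boundary_iff (q : Q) :
    letI := C.chartedSpace
    q ∈ I.boundary Q ↔ C.rep q ∈ I.boundary V := Iff.rfl

/-- Read in the preferred charts at `rep q` and at `q`, the parametrisation is the identity, and the
sign at `q` was chosen to be the sign at `rep q`. -/
theorem param_oriented_rep [IsManifold I ∞ V] (q : Q) :
    letI := C.chartedSpace
    OrientedLocalDiffeoAt I I σ (fun q => σ (C.rep q)) (C.param q) (C.rep q) := by
  let _ := C.chartedSpace
  have := C.isManifold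
  have hV : IsManifold I 1 V := IsManifold.of_le (n := ∞) (by simp)
  have hQ : IsManifold I 1 Q := IsManifold.of_le (n := ∞) (by simp)
  have hl : IsLocalDiffeomorphAt I I ∞ (C.param q) (C.rep q) := by
    let e := chartAt H (C.rep q) ≫ₕ (chartAt H q).symm
    refine ⟨{ toPartialEquiv := e.toPartialEquiv, open_source := e.open_source
              open_target := e.open_target
              contMDiffOn_toFun := ?_, contMDiffOn_invFun := ?_ }, ?_, ?_⟩
    · exact (contMDiffOn_chart_symm (I := I) (x := q)).comp
        (contMDiffOn_chart.mono Set.inter_subset_left) (fun x hx => hx.2)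
    · exact (contMDiffOn_chart_symm (I := I) (x := C.rep q)).comp
        (contMDiffOn_chart.mono Set.inter_subset_left) (fun x hx => hx.2)
    · refine ⟨mem_chart_source H (C.rep q), ?_⟩
      change chartAt H (C.rep q) (C.rep q) ∈ (chartAt H q).target
      exact (chartAt H q).map_source (mem_chart_source H q)
    · intro m hm
      change C.param q m = C.param q ((chartAt H (C.rep q)).symm (chartAt H (C.rep q) m))
      rw [(chartAt H (C.rep q)).left_inv hm.1]
  refine ⟨hl, ?_⟩
  have hm : MDifferentiableAt I I (C.param q) (C.rep q) := hl.mdifferentiableAt infty_ne_zero'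
  have hc : MDifferentiableAt I 𝓘(ℝ, E) (extChartAt I q) (C.param q (C.rep q)) := by
    apply mdifferentiableAt_extChartAt
    rw [C.param_rep]; exact mem_chart_source H q
  have h1 := chartDeriv_comp hc hm
  have h2 : (extChartAt I q) ∘ (C.param q) =ᶠ[𝓝 (C.rep q)] extChartAt I (C.rep q) := by
    filter_upwards [(C.param q).open_source.mem_nhds (C.rep_mem q)] with m hm
    change extChartAt I (C.rep q) ((C.param q).symm (C.param q m)) = _
    rw [(C.param q).left_inv hm]
  have h3 : chartDeriv I 𝓘(ℝ, E) ((extChartAt I q) ∘ (C.param q)) (C.rep q) =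
    chartDeriv I 𝓘(ℝ, E) (extChartAt I (C.rep q)) (C.rep q) := h2.mfderiv_eq
  rw [h3, chartDeriv_extChartAt_self, C.param_rep, chartDeriv_extChartAt_self,
    ContinuousLinearMap.id_comp] at h1
  rw [← h1, C.param_rep]
  have h4 : (ContinuousLinearMap.id ℝ E).det = 1 := LinearMap.det_id
  rw [h4]; simp

/-- The transition map from `param y` to `param q` is oriented at `rep y`, and so is `param y` by
`param_oriented_rep`; cancelling `param y` leaves the inverse of `param q` at `y`. -/
theorem param_symm_oriented [IsManifold I ∞ V] (q y : Q) (hy : y ∈ (C.param q).target) :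
    letI := C.chartedSpace
    OrientedLocalDiffeoAt I I (fun q => σ (C.rep q)) σ (C.param q).symm y := by
  let _ := C.chartedSpace
  have h := (C.param_oriented_rep y).of_comp (C.transition y q _ (C.rep_mem y)
    (by rwa [C.param_rep]))
  rwa [C.param_rep] at h

theorem param_oriented [IsManifold I ∞ V] (q : Q) (m : V) (hm : m ∈ (C.param q).source) :
    letI := C.chartedSpace
    OrientedLocalDiffeoAt I I σ (fun q => σ (C.rep q)) (C.param q) m := by
  let _ := C.chartedSpace
  have hy := (C.param q).map_source hm
  have h := (C.param_symm_oriented q _ hy).of_comp (g := C.param q) (υ := fun q => σ (C.rep q))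
    (L := I) ((OrientedLocalDiffeoAt.id _ _).congr_of_eventuallyEq (by
      filter_upwards [(C.param q).open_target.mem_nhds hy] with x hx
      exact (C.param q).right_inv hx))
  rwa [(C.param q).left_inv hm] at h

/-- The chart at `q` factors through the inverse of `param q`. The sign inequalities for the two
factors multiply, and the sign at the intermediate point of `V` occurs squared. -/
theorem isOrientation [IsManifold I ∞ V] (hσ : IsOrientation I σ) :
    letI := C.chartedSpace
    IsOrientation I (fun q : Q => σ (C.rep q)) := by
  let _ := C.chartedSpace
  intro q
  have hcont := (C.param q).continuousAt_symm (C.mem_target q)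
  have hp := hcont.eventually ((hσ (C.rep q)).and (chart_source_mem_nhds H (C.rep q)))
  filter_upwards [hp, (C.param q).open_target.mem_nhds (C.mem_target q)] with y ⟨hy, hys⟩ hyt
  have hs := C.param_symm_oriented q y hyt
  have h1 := chartDeriv_comp (mdifferentiableAt_extChartAt (I := I) hys)
    (hs.1.mdifferentiableAt infty_ne_zero')
  have hd : (chartDeriv I 𝓘(ℝ, E) (extChartAt I q) y).det =
      (chartDeriv I 𝓘(ℝ, E) (extChartAt I (C.rep q)) ((C.param q).symm y)).det *
      (chartDeriv I I (C.param q).symm y).det := by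
    rw [C.extChartAt_eq, h1]; exact LinearMap.det_comp _ _
  rw [hd]
  have h2 := mul_pos hy hs.2
  have h3 : (((σ ((C.param q).symm y) : ℤ)) : ℝ) * ((σ ((C.param q).symm y) : ℤ) : ℝ) = 1 := by
    norm_cast; rw [Int.units_mul_self]; simp
  push_cast at h2 ⊢
  linear_combination h2 + (((σ (C.rep q) : ℤ) : ℝ) * ((σ (C.rep y) : ℤ) : ℝ) *
    (chartDeriv I 𝓘(ℝ, E) (extChartAt I (C.rep q)) ((C.param q).symm y)).det *
      (chartDeriv I I (C.param q).symm y).det) * h3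

end OrientedCover

/-! ### The half line: flip and collapse -/

section halfLine
open WithLp Set

/-- The point of `[0,∞)` with coordinate `max r 0`. -/
noncomputable def halfLinePoint (r : ℝ) : EuclideanHalfSpace 1 := (𝓡∂ 1).symm (toLp 2 fun _ => r)

theorem halfLinePoint_coe (r : ℝ) : (halfLinePoint r).1 0 = max r 0 := by
  simp [halfLinePoint, modelWithCornersEuclideanHalfSpace_symm_apply]

theorem continuous_halfLinePoint : Continuous halfLinePoint :=
  (𝓡∂ 1).continuous_symm.comp (by fun_prop)

theorem continuous_halfLineCoord : Continuous fun t : EuclideanHalfSpace 1 => t.1 0 :=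
  contMDiff_halfSpaceCoord.continuous

theorem halfLinePoint_coord (t : EuclideanHalfSpace 1) : halfLinePoint (t.1 0) = t :=
  halfSpace_ext ((halfLinePoint_coe _).trans (max_eq_left t.2))

theorem isCompact_halfLine_le (r : ℝ) : IsCompact {t : EuclideanHalfSpace 1 | t.1 0 ≤ r} := by
  refine (isCompact_Icc.image (s := Icc 0 r) continuous_halfLinePoint).of_isClosed_subset
    (isClosed_le continuous_halfLineCoord continuous_const) ?_
  intro t ht
  exact ⟨t.1 0, ⟨t.2, ht⟩, halfLinePoint_coord t⟩

theorem isCompact_collar_le (N : Type*) [TopologicalSpace N] [CompactSpace N] (r : ℝ) :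
    IsCompact {z : N × EuclideanHalfSpace 1 | z.2.1 0 ≤ r} := by
  have h := isCompact_univ.prod (s := (univ : Set N)) (isCompact_halfLine_le r)
  convert! h using 1
  ext z
  simp

/-- The reflection `t ↦ 1 - t` of `[0,1]`, extended by zero. -/
noncomputable def flip (t : EuclideanHalfSpace 1) : EuclideanHalfSpace 1 :=
  halfLinePoint (1 - t.1 0)

theorem flip_coe (t : EuclideanHalfSpace 1) : (flip t).1 0 = max (1 - t.1 0) 0 :=
  halfLinePoint_coe _

theorem continuous_flip : Continuous flip :=
  continuous_halfLinePoint.comp (continuous_const.sub continuous_halfLineCoord)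

theorem flip_flip {t : EuclideanHalfSpace 1} (ht : t.1 0 ≤ 1) : flip (flip t) = t := by
  apply halfSpace_ext
  rw [flip_coe, flip_coe, max_eq_left (sub_nonneg.2 ht), sub_sub_cancel, max_eq_left t.2]

theorem flip_le_one (t : EuclideanHalfSpace 1) : (flip t).1 0 ≤ 1 := by
  rw [flip_coe]
  exact max_le (by linarith [t.2]) zero_le_one

theorem contMDiffOn_flip :
    ContMDiffOn (𝓡∂ 1) (𝓡∂ 1) ∞ flip {t : EuclideanHalfSpace 1 | t.1 0 ≤ 1} := by
  have h1 : ContMDiff (𝓡∂ 1) 𝓘(ℝ, EuclideanSpace ℝ (Fin 1)) ∞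
      (fun t : EuclideanHalfSpace 1 => (toLp 2 fun _ => 1 - t.1 0 : EuclideanSpace ℝ (Fin 1))) := by
    have h2 : ContDiff ℝ ∞ (fun r : ℝ => (toLp 2 fun _ => 1 - r : EuclideanSpace ℝ (Fin 1))) := by
      rw [contDiff_euclidean]
      intro i
      fun_prop
    exact h2.contMDiff.comp contMDiff_halfSpaceCoord
  refine (ModelWithCorners.contMDiffOn_symm (𝓡∂ 1)).comp h1.contMDiffOn ?_
  intro t ht
  rw [range_modelWithCornersEuclideanHalfSpace]
  simpa using ht

theorem chartDeriv_halfLineCoord (t : EuclideanHalfSpace 1) (v : EuclideanSpace ℝ (Fin 1)) :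
    chartDeriv (𝓡∂ 1) 𝓘(ℝ, ℝ) (fun y : EuclideanHalfSpace 1 => y.1 0) t v = v 0 := by
  have hI : MDifferentiableAt (𝓡∂ 1) 𝓘(ℝ, EuclideanSpace ℝ (Fin 1)) (extChartAt (𝓡∂ 1) t) t :=
    mdifferentiableAt_extChartAt (mem_chart_source _ t)
  have h := mfderiv_coord hI v
  rw [chartDeriv_extChartAt_self] at h
  exact h

/-- Reversal of orientation is expressed by the sign `-1` on the target. Near `t` the truncation is
inactive, so the coordinate of `flip` is one minus the coordinate, and the chain rule gives the
determinant `-1`. -/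
theorem flip_oriented {t : EuclideanHalfSpace 1} (h0 : 0 < t.1 0) (h1 : t.1 0 < 1) :
    OrientedLocalDiffeoAt (𝓡∂ 1) (𝓡∂ 1) (fun _ => 1) (fun _ => -1) flip t := by
  have ho : IsOpen {t : EuclideanHalfSpace 1 | 0 < t.1 0 ∧ t.1 0 < 1} :=
    (isOpen_lt continuous_const continuous_halfLineCoord).inter
      (isOpen_lt continuous_halfLineCoord continuous_const)
  have hm : ∀ t ∈ {t : EuclideanHalfSpace 1 | 0 < t.1 0 ∧ t.1 0 < 1},
      flip t ∈ {t : EuclideanHalfSpace 1 | 0 < t.1 0 ∧ t.1 0 < 1} := by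
    rintro t ⟨h, h'⟩
    change 0 < (flip t).1 0 ∧ (flip t).1 0 < 1
    rw [flip_coe, max_eq_left (by linarith)]
    constructor <;> linarith
  have hs : ContMDiffOn (𝓡∂ 1) (𝓡∂ 1) ∞ flip {t : EuclideanHalfSpace 1 | 0 < t.1 0 ∧ t.1 0 < 1} :=
    contMDiffOn_flip.mono fun t ht => ht.2.le
  have hl : IsLocalDiffeomorphAt (𝓡∂ 1) (𝓡∂ 1) ∞ flip t :=
    ⟨{ toFun := flip, invFun := flip, source := {t | 0 < t.1 0 ∧ t.1 0 < 1},
       target := {t | 0 < t.1 0 ∧ t.1 0 < 1}, map_source' := hm, map_target' := hm,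
       left_inv' := fun t ht => flip_flip ht.2.le, right_inv' := fun t ht => flip_flip ht.2.le,
       open_source := ho, open_target := ho, contMDiffOn_toFun := hs, contMDiffOn_invFun := hs },
      ⟨h0, h1⟩, fun _ _ => rfl⟩
  refine ⟨hl, ?_⟩
  have hd : HasMFDerivAt 𝓘(ℝ, ℝ) 𝓘(ℝ, ℝ) (fun r : ℝ => 1 - r) (t.1 0)
      (-(ContinuousLinearMap.id ℝ ℝ)) :=
    ((hasFDerivAt_id (𝕜 := ℝ) (t.1 0)).const_sub 1).hasMFDerivAt
  have hd' : chartDeriv 𝓘(ℝ, ℝ) 𝓘(ℝ, ℝ) (fun r : ℝ => 1 - r) (t.1 0) =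
      -(ContinuousLinearMap.id ℝ ℝ) := hd.mfderiv
  have hc (t) : MDifferentiableAt (𝓡∂ 1) 𝓘(ℝ, ℝ) (fun y : EuclideanHalfSpace 1 => y.1 0) t :=
    (contMDiff_halfSpaceCoord t).mdifferentiableAt (by simp)
  have e1 := chartDeriv_comp (hc (flip t)) (hl.mdifferentiableAt infty_ne_zero')
  have e2 := chartDeriv_comp (f := fun y : EuclideanHalfSpace 1 => y.1 0) hd.mdifferentiableAt (hc t)
  have he : (fun y : EuclideanHalfSpace 1 => y.1 0) ∘ flip =ᶠ[𝓝 t]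
      (fun r : ℝ => 1 - r) ∘ (fun y : EuclideanHalfSpace 1 => y.1 0) := by
    filter_upwards [ho.mem_nhds ⟨h0, h1⟩] with s hs
    exact (flip_coe s).trans (max_eq_left (sub_nonneg.2 hs.2.le))
  have e3 : chartDeriv (𝓡∂ 1) 𝓘(ℝ, ℝ) ((fun y : EuclideanHalfSpace 1 => y.1 0) ∘ flip) t =
    chartDeriv (𝓡∂ 1) 𝓘(ℝ, ℝ) ((fun r : ℝ => 1 - r) ∘ (fun y : EuclideanHalfSpace 1 => y.1 0)) t :=
    he.mfderiv_eq
  rw [e1, e2, hd'] at e3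
  have e4 := congrArg (fun A : EuclideanSpace ℝ (Fin 1) →L[ℝ] ℝ => A (EuclideanSpace.single 0 1)) e3
  have e5 := chartDeriv_halfLineCoord (flip t)
    (chartDeriv (𝓡∂ 1) (𝓡∂ 1) flip t (EuclideanSpace.single 0 1))
  have e6 := chartDeriv_halfLineCoord t (EuclideanSpace.single 0 1)
  rw [det_fin_one, ← e5]
  have e7 : chartDeriv (𝓡∂ 1) 𝓘(ℝ, ℝ) (fun y : EuclideanHalfSpace 1 => y.1 0) (flip t)
    (chartDeriv (𝓡∂ 1) (𝓡∂ 1) flip t (EuclideanSpace.single 0 1)) = -1 := by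
    refine e4.trans ?_
    change -(chartDeriv (𝓡∂ 1) 𝓘(ℝ, ℝ) (fun y : EuclideanHalfSpace 1 => y.1 0) t
      (EuclideanSpace.single 0 1)) = -1
    rw [e6]; simp
  rw [e7]; simp

/-- A map `[0,∞) → [0,∞)` that is zero on `[0,1]` and the identity on `[2,∞)`. -/
noncomputable def collapse (t : EuclideanHalfSpace 1) : EuclideanHalfSpace 1 :=
  halfLinePoint (min (2 * (t.1 0 - 1)) (t.1 0))

theorem continuous_collapse : Continuous collapse :=
  continuous_halfLinePoint.comp (((continuous_halfLineCoord.sub continuous_const).const_mul 2).min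
    continuous_halfLineCoord)

theorem collapse_of_le {t : EuclideanHalfSpace 1} (h : t.1 0 ≤ 1) : collapse t = 0 := by
  apply halfSpace_ext
  rw [collapse, halfLinePoint_coe]
  exact max_eq_right ((min_le_left _ _).trans (by linarith))

theorem collapse_of_ge {t : EuclideanHalfSpace 1} (h : 2 ≤ t.1 0) : collapse t = t := by
  rw [collapse, min_eq_right (by linarith), halfLinePoint_coord]

end halfLine

/-! ### The topology of gluing two collars -/

/-- A self map of an open subset that is the identity off a set with closed image extends
continuously by the identity. -/
theorem continuous_extend_id {D V : Type*} [TopologicalSpace D] [TopologicalSpace V] {e : D → V}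
    (he : Topology.IsOpenEmbedding e) {ψ : D → D} (hψ : Continuous ψ) {K : Set D}
    (hK : IsClosed (e '' K)) (h : ∀ z ∉ K, ψ z = z) :
    Continuous (Function.extend e (e ∘ ψ) id) := by
  rw [continuous_iff_continuousAt]
  intro v
  by_cases hv : v ∈ e '' K
  · obtain ⟨z, -, rfl⟩ := hv
    rw [← he.continuousAt_iff]
    have h1 : Function.extend e (e ∘ ψ) id ∘ e = e ∘ ψ :=
      funext fun z => he.injective.extend_apply _ _ z
    rw [h1]
    exact (he.continuous.comp hψ).continuousAt
  · refine continuousAt_id.congr ?_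
    filter_upwards [hK.isOpen_compl.mem_nhds hv] with w hw
    by_cases hr : ∃ z, e z = w
    · obtain ⟨z, rfl⟩ := hr
      rw [he.injective.extend_apply]
      have hz : z ∉ K := fun hz => hw ⟨z, hz, rfl⟩
      rw [Function.comp, h z hz]; rfl
    · rw [Function.extend_apply' _ _ _ hr]

/-- Two disjoint open collars `N × [0,∞) → V`. -/
structure TwoCollars (N V : Type*) [TopologicalSpace N] [TopologicalSpace V] where
  c : N × EuclideanHalfSpace 1 → V
  c' : N × EuclideanHalfSpace 1 → V
  emb : Topology.IsOpenEmbedding (Sum.elim c c')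

namespace TwoCollars
variable {N V : Type*} [TopologicalSpace N] [TopologicalSpace V] (P : TwoCollars N V)

/-- The two collars in the other order. -/
def swap : TwoCollars N V where
  c := P.c'
  c' := P.c
  emb := by
    have h := P.emb.comp (Homeomorph.sumComm _ _).isOpenEmbedding
    convert! h using 1
    ext (z | z) <;> rfl

theorem emb_left : Topology.IsOpenEmbedding P.c := P.emb.comp Topology.IsOpenEmbedding.inl

theorem emb_right : Topology.IsOpenEmbedding P.c' := P.emb.comp Topology.IsOpenEmbedding.inr

theorem ne (z z' : N × EuclideanHalfSpace 1) : P.c z ≠ P.c' z' := fun h =>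
  Sum.inl_ne_inr (P.emb.injective (a₁ := Sum.inl z) (a₂ := Sum.inr z') h)

/-- The relation that identifies `c (x, t)` with `c' (x, 1 - t)`. -/
def Rel (v v' : V) : Prop :=
  ∃ (x : N) (t : EuclideanHalfSpace 1), t.1 0 ≤ 1 ∧ P.c (x, t) = v ∧ P.c' (x, flip t) = v'

/-- The flip is an involution where `t ≤ 1`; by this symmetry a statement about one collar yields
the one about the other. -/
theorem rel_swap {v v' : V} : P.swap.Rel v v' ↔ P.Rel v' v := by
  constructor
  · rintro ⟨x, t, ht, rfl, rfl⟩
    exact ⟨x, flip t, flip_le_one t, rfl, by rw [flip_flip ht]; rfl⟩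
  · rintro ⟨x, t, ht, rfl, rfl⟩
    exact ⟨x, flip t, flip_le_one t, rfl, by rw [flip_flip ht]; rfl⟩

theorem Rel.right_unique {P : TwoCollars N V} {v w w' : V} (h : P.Rel v w) (h' : P.Rel v w') :
    w = w' := by
  obtain ⟨x, t, ht, rfl, rfl⟩ := h
  obtain ⟨y, s, hs, h1, rfl⟩ := h'
  rw [P.emb_left.injective h1.symm |> fun h => (Prod.mk.inj h).1,
    P.emb_left.injective h1.symm |> fun h => (Prod.mk.inj h).2]

theorem Rel.left_unique {P : TwoCollars N V} {v v' w : V} (h : P.Rel v w) (h' : P.Rel v' w) :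
    v = v' :=
  (P.rel_swap.2 h).right_unique (P.rel_swap.2 h')

/-- The collars are disjoint, so identifications never chain and a class has at most two points. -/
theorem Rel.not_trans {P : TwoCollars N V} {v w w' : V} (h : P.Rel v w) (h' : P.Rel w w') :
    False := by
  obtain ⟨x, t, ht, rfl, rfl⟩ := h
  obtain ⟨y, s, hs, h1, rfl⟩ := h'
  exact P.ne _ _ h1

/-- The complement of the ends of the collars. -/
def interior : Set V :=
  (Set.range (fun x => P.c (x, 0)) ∪ Set.range (fun x => P.c' (x, 0)))ᶜ

theorem interior_swap : P.swap.interior = P.interior := by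
  rw [interior, interior, Set.union_comm]; rfl

theorem isOpen_interior [CompactSpace N] [T2Space V] : IsOpen P.interior := by
  refine (IsClosed.union ?_ ?_).isOpen_compl
  · exact (isCompact_range (P.emb_left.continuous.comp (by fun_prop))).isClosed
  · exact (isCompact_range (P.emb_right.continuous.comp (by fun_prop))).isClosed

theorem coord_pos {x : N} {t : EuclideanHalfSpace 1} (h : P.c (x, t) ∈ P.interior) :
    0 < t.1 0 := by
  refine lt_of_le_of_ne t.2 fun h0 => h (Or.inl ⟨x, ?_⟩)
  have : t = 0 := halfSpace_ext h0.symm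
  rw [this]

/-- For `t ≥ 1` the truncated flip is `0`, and `c' (x, 0)` is a removed end. -/
theorem coord_lt_one {x : N} {t : EuclideanHalfSpace 1} (h : P.c' (x, flip t) ∈ P.interior) :
    t.1 0 < 1 := by
  have h1 := P.swap.coord_pos (x := x) (t := flip t) (by rw [interior_swap]; exact h)
  rw [flip_coe] at h1
  by_contra h2
  rw [max_eq_right (by linarith)] at h1
  exact lt_irrefl _ h1

/-- The relation is a continuous image of the compact set `N × [0,1]`. The values `t = 0` and `t =
1`, which do not occur in the quotient, are admitted in `Rel` for the sake of this compactness. -/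
theorem isClosed_rel [CompactSpace N] [T2Space V] : IsClosed {q : V × V | P.Rel q.1 q.2} := by
  have h : {q : V × V | P.Rel q.1 q.2} = (fun z : N × EuclideanHalfSpace 1 =>
      (P.c z, P.c' (z.1, flip z.2))) '' {z | z.2.1 0 ≤ 1} := by
    ext ⟨v, v'⟩
    constructor
    · rintro ⟨x, t, ht, rfl, rfl⟩
      exact ⟨(x, t), ht, rfl⟩
    · rintro ⟨⟨x, t⟩, ht, h⟩
      exact ⟨x, t, ht, congrArg Prod.fst h, congrArg Prod.snd h⟩
  rw [h]
  refine ((isCompact_collar_le N 1).image (P.emb_left.continuous.prodMk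
    (P.emb_right.continuous.comp (continuous_fst.prodMk ?_)))).isClosed
  exact continuous_flip.comp continuous_snd

/-- Since `O` avoids the removed ends, the condition `t ≤ 1` is automatic, and the set is the image
under the open map `c` of an open set. -/
theorem isOpen_rel_image {O : Set V} (hO : IsOpen O) (hOM : O ⊆ P.interior) :
    IsOpen {v | ∃ w ∈ O, P.Rel v w} := by
  have h : {v | ∃ w ∈ O, P.Rel v w} =
      P.c '' ((fun z => P.c' (z.1, flip z.2)) ⁻¹' O) := by
    ext v
    constructor
    · rintro ⟨_, hw, x, t, ht, rfl, rfl⟩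
      exact ⟨(x, t), hw, rfl⟩
    · rintro ⟨⟨x, t⟩, hw, rfl⟩
      exact ⟨_, hw, x, t, (P.coord_lt_one (hOM hw)).le, rfl, rfl⟩
  rw [h]
  apply P.emb_left.isOpenMap
  exact hO.preimage (P.emb_right.continuous.comp
    (continuous_fst.prodMk (continuous_flip.comp continuous_snd)))

/-- The identification of the two collars. -/
def setoid : Setoid P.interior where
  r m m' := m = m' ∨ P.Rel m m' ∨ P.Rel m' m
  iseqv :=
    { refl := fun _ => Or.inl rfl
      symm := by
        rintro m m' (h | h | h)
        · exact Or.inl h.symm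
        · exact Or.inr (Or.inr h)
        · exact Or.inr (Or.inl h)
      trans := by
        rintro m m' m'' (rfl | h | h) h'
        · exact h'
        · rcases h' with rfl | h' | h'
          · exact Or.inr (Or.inl h)
          · exact (h.not_trans h').elim
          · exact Or.inl (Subtype.ext (h.left_unique h'))
        · rcases h' with rfl | h' | h'
          · exact Or.inr (Or.inr h)
          · exact Or.inl (Subtype.ext (h.right_unique h'))
          · exact (h'.not_trans h).elim }

/-- The space obtained from `V` by removing the ends of the collars and gluing the collars. -/
def Glued : Type _ := Quotient P.setoid

instance : TopologicalSpace P.Glued := inferInstanceAs (TopologicalSpace (Quotient P.setoid))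

/-- The quotient map. -/
def proj (m : P.interior) : P.Glued := Quotient.mk P.setoid m

theorem proj_eq_iff {m m' : P.interior} :
    P.proj m = P.proj m' ↔ m = m' ∨ P.Rel m m' ∨ P.Rel m' m := Quotient.eq (r := P.setoid)

theorem proj_surjective : Function.Surjective P.proj := Quotient.mk_surjective

theorem continuous_proj : Continuous P.proj := continuous_quotient_mk'

/-- The map of `V` to itself that collapses the collars `N × [0,1]` to their ends. -/
noncomputable def collapseMap : V → V :=
  Function.extend (Sum.elim P.c P.c') (Sum.elim P.c P.c' ∘
    Sum.map (Prod.map id collapse) (Prod.map id collapse)) id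

theorem collapseMap_left {x : N} {t : EuclideanHalfSpace 1} (ht : t.1 0 ≤ 1) :
    P.collapseMap (P.c (x, t)) = P.c (x, 0) := by
  refine (P.emb.injective.extend_apply _ _ (Sum.inl (x, t))).trans ?_
  change P.c (x, collapse t) = _
  rw [collapse_of_le ht]

theorem collapseMap_right {x : N} {t : EuclideanHalfSpace 1} (ht : t.1 0 ≤ 1) :
    P.collapseMap (P.c' (x, t)) = P.c' (x, 0) := by
  refine (P.emb.injective.extend_apply _ _ (Sum.inr (x, t))).trans ?_
  change P.c' (x, collapse t) = _
  rw [collapse_of_le ht]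

theorem collapseMap_of_notMem {v : V} (h : ∀ z, P.c z ≠ v) (h' : ∀ z, P.c' z ≠ v) :
    P.collapseMap v = v :=
  Function.extend_apply' _ _ _ (by rintro ⟨z | z, hz⟩; exacts [h z hz, h' z hz])

variable [CompactSpace N] [T2Space V]

/-- The saturation of an open set `O` is `O` together with its images under the identification in
both directions. -/
theorem isOpenMap_proj : IsOpenMap P.proj := by
  intro O hO
  have h : IsOpen (P.proj ⁻¹' (P.proj '' O)) := by
    have hO' : IsOpen (Subtype.val '' O) := P.isOpen_interior.isOpenMap_subtype_val O hO
    have hOM : Subtype.val '' O ⊆ P.interior := by rintro _ ⟨m, -, rfl⟩; exact m.2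
    have h1 := (P.isOpen_rel_image hO' hOM).preimage continuous_subtype_val (X := P.interior)
    have h2 := (P.swap.isOpen_rel_image hO' (by rwa [interior_swap])).preimage
      continuous_subtype_val (X := P.interior)
    convert! (hO.union h1).union h2 using 1
    ext m
    constructor
    · rintro ⟨w, hw, h⟩
      rcases P.proj_eq_iff.1 h with rfl | h | h
      · exact Or.inl (Or.inl hw)
      · exact Or.inr ⟨w, ⟨w, hw, rfl⟩, P.rel_swap.2 h⟩
      · exact Or.inl (Or.inr ⟨w, ⟨w, hw, rfl⟩, h⟩)
    · rintro ((hm | ⟨_, ⟨w, hw, rfl⟩, h⟩) | ⟨_, ⟨w, hw, rfl⟩, h⟩)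
      · exact ⟨m, hm, rfl⟩
      · exact ⟨w, hw, P.proj_eq_iff.2 (Or.inr (Or.inr h))⟩
      · exact ⟨w, hw, P.proj_eq_iff.2 (Or.inr (Or.inl (P.rel_swap.1 h)))⟩
  exact h

theorem isOpenQuotientMap_proj : IsOpenQuotientMap P.proj :=
  ⟨P.proj_surjective, P.continuous_proj, P.isOpenMap_proj⟩

/-- The quotient map is open, so it suffices that the equivalence relation is closed; it is the
union of the diagonal, `Rel` and its transpose. -/
instance : T2Space P.Glued := by
  rw [t2Space_iff_of_isOpenQuotientMap P.isOpenQuotientMap_proj]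
  have h1 : IsClosed {q : P.interior × P.interior | q.1 = q.2} := isClosed_diagonal
  have hc : Continuous fun q : P.interior × P.interior => ((q.1 : V), (q.2 : V)) := by fun_prop
  have hc' : Continuous fun q : P.interior × P.interior => ((q.2 : V), (q.1 : V)) := by fun_prop
  have h2 := P.isClosed_rel.preimage hc
  have h3 := P.isClosed_rel.preimage hc'
  convert! h1.union (h2.union h3) using 1
  ext q
  exact P.proj_eq_iff

theorem isClosed_collar_le (r : ℝ) : IsClosed (P.c '' {z | z.2.1 0 ≤ r}) :=
  ((isCompact_collar_le N r).image P.emb_left.continuous).isClosed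

/-- Two distinct identified points lie one in each of the closed pieces `t ≤ 1` of the collars. The
quotient map is therefore injective on the complement of either piece, and `m` lies in one of these
complements. -/
theorem exists_nhds_injOn (m : P.interior) : ∃ O ∈ 𝓝 m, IsOpen O ∧ Set.InjOn P.proj O := by
  by_cases hm : (m : V) ∈ P.c '' {z | z.2.1 0 ≤ 1}
  · have ho := ((P.swap.isClosed_collar_le 1).isOpen_compl).preimage
      continuous_subtype_val (X := P.interior)
    refine ⟨_, ho.mem_nhds ?_, ho, ?_⟩
    · rintro ⟨z, -, h⟩
      obtain ⟨z', -, h'⟩ := hm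
      exact P.ne _ _ (h'.trans h.symm)
    · intro w hw w' hw' h
      rcases P.proj_eq_iff.1 h with h | ⟨x, t, ht, h1, h2⟩ | ⟨x, t, ht, h1, h2⟩
      · exact h
      · exact (hw' ⟨(x, flip t), flip_le_one t, h2⟩).elim
      · exact (hw ⟨(x, flip t), flip_le_one t, h2⟩).elim
  · have ho := ((P.isClosed_collar_le 1).isOpen_compl).preimage
      continuous_subtype_val (X := P.interior)
    refine ⟨_, ho.mem_nhds hm, ho, ?_⟩
    intro w hw w' hw' h
    rcases P.proj_eq_iff.1 h with h | ⟨x, t, ht, h1, h2⟩ | ⟨x, t, ht, h1, h2⟩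
    · exact h
    · exact (hw ⟨(x, t), ht, h1⟩).elim
    · exact (hw' ⟨(x, t), ht, h1⟩).elim

theorem isLocalHomeomorph_proj : IsLocalHomeomorph P.proj := by
  rw [isLocalHomeomorph_iff_isOpenEmbedding_restrict]
  intro m
  obtain ⟨O, hO, hOo, hi⟩ := P.exists_nhds_injOn m
  exact ⟨O, hO, Topology.IsOpenEmbedding.of_continuous_injective_isOpenMap
    (P.continuous_proj.comp continuous_subtype_val) (Set.injOn_iff_injective.1 hi)
    (P.isOpenMap_proj.domRestrict hOo)⟩

/-- Of the coordinates `t` and `1 - t` one is at least `1 / 2`. Hence every class meets the compact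
set that remains when the pieces `t < 1 / 2` of both collars are removed from `V`. -/
instance [CompactSpace V] : CompactSpace P.Glued := by
  let O : Set V := P.c '' {z | z.2.1 0 < 1 / 2} ∪ P.c' '' {z | z.2.1 0 < 1 / 2}
  have ho : IsOpen {z : N × EuclideanHalfSpace 1 | z.2.1 0 < 1 / 2} :=
    isOpen_lt (continuous_halfLineCoord.comp continuous_snd) continuous_const
  have hO : IsOpen O := (P.emb_left.isOpenMap _ ho).union (P.emb_right.isOpenMap _ ho)
  have h0 : (0 : EuclideanHalfSpace 1).1 0 < 1 / 2 := by
    change (0 : ℝ) < 1 / 2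
    norm_num
  have hOM : Oᶜ ⊆ P.interior := by
    intro v hv
    rintro (⟨x, rfl⟩ | ⟨x, rfl⟩)
    · exact hv (Or.inl ⟨(x, 0), h0, rfl⟩)
    · exact hv (Or.inr ⟨(x, 0), h0, rfl⟩)
  have hK : IsCompact (Subtype.val ⁻¹' Oᶜ : Set P.interior) := by
    rw [Subtype.isCompact_iff, Subtype.image_preimage_coe, Set.inter_eq_right.2 hOM]
    exact hO.isClosed_compl.isCompact
  refine ⟨?_⟩
  convert! hK.image P.continuous_proj
  symm
  rw [Set.eq_univ_iff_forall]
  intro q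
  obtain ⟨m, rfl⟩ := P.proj_surjective q
  -- Stated for all pairs of collars, so that `P.swap` covers the points of the second collar.
  have key : ∀ (P : TwoCollars N V) (m : P.interior), (m : V) ∈ P.c '' {z | z.2.1 0 < 1 / 2} →
      ∃ w : P.interior, P.Rel m w ∧
        (w : V) ∉ P.c '' {z | z.2.1 0 < 1 / 2} ∪ P.c' '' {z | z.2.1 0 < 1 / 2} := by
    rintro P m ⟨⟨x, t⟩, ht, h⟩
    have ht : t.1 0 < 1 / 2 := ht
    have hf : (flip t).1 0 = 1 - t.1 0 := by
      rw [flip_coe, max_eq_left (by linarith)]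
    refine ⟨⟨P.c' (x, flip t), ?_⟩, ⟨x, t, by linarith, h, rfl⟩, ?_⟩
    · rintro (⟨y, h⟩ | ⟨y, h⟩)
      · exact P.ne _ _ h
      · have h1 := congrArg Prod.snd (P.emb_right.injective h)
        have h2 : (0 : ℝ) = (flip t).1 0 := congrArg (fun s : EuclideanHalfSpace 1 => s.1 0) h1
        linarith
    · rintro (⟨z, -, h⟩ | ⟨z, hz, h⟩)
      · exact P.ne _ _ h
      · rw [P.emb_right.injective h] at hz
        have hz : (flip t).1 0 < 1 / 2 := hz
        linarith
  by_cases hm : (m : V) ∈ O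
  · rcases hm with hm | hm
    · obtain ⟨w, hw, hw'⟩ := key P m hm
      exact ⟨w, hw', P.proj_eq_iff.2 (Or.inr (Or.inr hw))⟩
    · obtain ⟨⟨w, hwi⟩, hw, hw'⟩ := key P.swap ⟨m, by rw [interior_swap]; exact m.2⟩ hm
      rw [interior_swap] at hwi
      refine ⟨⟨w, hwi⟩, fun h => hw' h.symm, P.proj_eq_iff.2 (Or.inr (Or.inl ?_))⟩
      exact P.rel_swap.1 hw
  · exact ⟨m, hm, rfl⟩

theorem continuous_collapseMap : Continuous P.collapseMap := by
  have hψ : Continuous (Prod.map id collapse : N × EuclideanHalfSpace 1 → _) :=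
    continuous_id.prodMap continuous_collapse
  -- `collapse` is the identity from `t = 2` on, and the part of the collars with `t ≤ 2` is
  -- compact, hence closed in `V`.
  refine continuous_extend_id P.emb (hψ.sumMap hψ)
    (K := Sum.elim (fun z => z.2.1 0 ≤ 2) (fun z => z.2.1 0 ≤ 2)) ?_ ?_
  · convert! (P.isClosed_collar_le 2).union (P.swap.isClosed_collar_le 2) using 1
    ext v
    constructor
    · rintro ⟨z | z, h, rfl⟩
      · exact Or.inl ⟨z, h, rfl⟩
      · exact Or.inr ⟨z, h, rfl⟩
    · rintro (⟨z, h, rfl⟩ | ⟨z, h, rfl⟩)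
      · exact ⟨Sum.inl z, h, rfl⟩
      · exact ⟨Sum.inr z, h, rfl⟩
  · have key : ∀ z : N × EuclideanHalfSpace 1, ¬ (z.2.1 0 ≤ 2) → Prod.map id collapse z = z :=
      fun z hz => Prod.ext rfl (collapse_of_ge (not_le.1 hz).le)
    rintro (z | z) hz
    · exact congrArg Sum.inl (key z hz)
    · exact congrArg Sum.inr (key z hz)

/-- A map that agrees on the two ends descends, after collapsing the collars, to the glued
space. -/
noncomputable def descend {A : Type*} [TopologicalSpace A] (h : C(V, A))
    (hc : ∀ x, h (P.c (x, 0)) = h (P.c' (x, 0))) : C(P.Glued, A) where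
  toFun := Quotient.lift (s := P.setoid) (fun m => h (P.collapseMap m)) (by
    -- Identified points collapse to the two ends over the same point of `N`, where `h` agrees.
    -- Without the collapse `h` need not be compatible with the flip.
    have key : ∀ v v', P.Rel v v' → h (P.collapseMap v) = h (P.collapseMap v') := by
      rintro _ _ ⟨x, t, ht, rfl, rfl⟩
      rw [P.collapseMap_left ht, P.collapseMap_right (flip_le_one t), hc]
    rintro m m' (rfl | h | h)
    · rfl
    · exact key _ _ h
    · exact (key _ _ h).symm)
  continuous_toFun := Continuous.quotient_lift
    (h.continuous.comp (P.continuous_collapseMap.comp continuous_subtype_val)) _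

end TwoCollars

/-! ### The smooth structure and orientation of the glued space -/

namespace TwoCollars

section param
variable {N V : Type*} [TopologicalSpace N] [TopologicalSpace V] (P : TwoCollars N V)

/-- `Φ` is a restriction of the quotient map to an open set. -/
def IsParam (Φ : OpenPartialHomeomorph V P.Glued) : Prop :=
  ∀ v ∈ Φ.source, ∃ hv : v ∈ P.interior, Φ v = P.proj ⟨v, hv⟩

theorem exists_isParam [CompactSpace N] [T2Space V] (m : P.interior) :
    ∃ Φ : OpenPartialHomeomorph V P.Glued, P.IsParam Φ ∧ (m : V) ∈ Φ.source := by
  obtain ⟨e, hm, he⟩ := P.isLocalHomeomorph_proj m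
  let O : TopologicalSpace.Opens V := ⟨P.interior, P.isOpen_interior⟩
  let ι := O.openPartialHomeomorphSubtypeCoe ⟨m⟩
  have hι : ∀ w : P.interior, ι.symm w = w := fun w => ι.left_inv (x := w) (Set.mem_univ _)
  have ht : ι.target = P.interior := O.openPartialHomeomorphSubtypeCoe_target _
  refine ⟨ι.symm ≫ₕ e, ?_, ?_⟩
  · rintro v ⟨hv, -⟩
    have hv : v ∈ P.interior := ht ▸ hv
    refine ⟨hv, ?_⟩
    rw [he]
    exact congrArg e (hι ⟨v, hv⟩)
  · refine ⟨?_, ?_⟩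
    · change (m : V) ∈ ι.target
      rw [ht]; exact m.2
    · change ι.symm m ∈ e.source
      rw [hι]; exact hm

variable {P}

theorem IsParam.rel {Φ Φ' : OpenPartialHomeomorph V P.Glued} (h : P.IsParam Φ) (h' : P.IsParam Φ')
    {v : V} (hv : v ∈ Φ.source) (hv' : Φ v ∈ Φ'.target) :
    v = Φ'.symm (Φ v) ∨ P.Rel v (Φ'.symm (Φ v)) ∨ P.Rel (Φ'.symm (Φ v)) v := by
  obtain ⟨hi, he⟩ := h v hv
  obtain ⟨hi', he'⟩ := h' _ (Φ'.map_target hv')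
  have he2 := he.symm.trans ((Φ'.right_inv hv').symm.trans he')
  exact (P.proj_eq_iff.1 he2).imp_left (congrArg Subtype.val)

theorem IsParam.symm_apply {Φ Φ' : OpenPartialHomeomorph V P.Glued} (h : P.IsParam Φ)
    (h' : P.IsParam Φ') {v w : V} (hv : v ∈ Φ.source) (hw : w ∈ Φ'.source)
    (hvw : v = w ∨ P.Rel v w ∨ P.Rel w v) : Φ'.symm (Φ v) = w := by
  obtain ⟨hi, he⟩ := h v hv
  obtain ⟨hi', he'⟩ := h' w hw
  have : P.proj ⟨v, hi⟩ = P.proj ⟨w, hi'⟩ := by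
    rw [P.proj_eq_iff]
    exact hvw.imp_left Subtype.ext
  rw [he, this, ← he', Φ'.left_inv hw]

end param

section oriented
variable {p : ℕ} {N : CompactOrientedManifold (𝓡 p)}
  {V : CompactOrientedManifold ((𝓡 p).prod (𝓡∂ 1))} {P : TwoCollars N V}

/-- Near such a point the transition map is `c (x, t) ↦ c' (x, 1 - t)`. The collars carry opposite
orientations of `N` and the flip reverses the interval, so orientations are preserved. The auxiliary
pair `Q` stands for `P` or for `P.swap`. -/
theorem IsParam.oriented_of_rel {Φ Φ' : OpenPartialHomeomorph V P.Glued} (h : P.IsParam Φ)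
    (h' : P.IsParam Φ') {Q : TwoCollars N V} (hQ : ∀ {v w}, Q.Rel v w → P.Rel v w ∨ P.Rel w v)
    {ν ν' : N → ℤˣ} (hν : ∀ x, ν' x = - ν x)
    (hc : ∀ z, OrientedLocalDiffeoAt ((𝓡 p).prod (𝓡∂ 1)) ((𝓡 p).prod (𝓡∂ 1))
      (fun z : N × EuclideanHalfSpace 1 => ν z.1) V.orientation Q.c z)
    (hc' : ∀ z, OrientedLocalDiffeoAt ((𝓡 p).prod (𝓡∂ 1)) ((𝓡 p).prod (𝓡∂ 1))
      (fun z : N × EuclideanHalfSpace 1 => ν' z.1) V.orientation Q.c' z)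
    {v : V} (hv : v ∈ Φ.source) (hv' : Φ v ∈ Φ'.target) (hr : Q.Rel v (Φ'.symm (Φ v)))
    (hi : Q.interior = P.interior) :
    OrientedLocalDiffeoAt ((𝓡 p).prod (𝓡∂ 1)) ((𝓡 p).prod (𝓡∂ 1)) V.orientation V.orientation
      (Φ'.symm ∘ Φ) v := by
  obtain ⟨x, t, ht, rfl, h2⟩ := hr
  have hw := Φ'.map_target hv'
  obtain ⟨hi1, -⟩ := h _ hv
  obtain ⟨hi2, -⟩ := h' _ hw
  rw [← h2] at hw hi2
  rw [← hi] at hi1 hi2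
  have ht0 := Q.coord_pos hi1
  have ht1 := Q.coord_lt_one hi2
  have hf : OrientedLocalDiffeoAt ((𝓡 p).prod (𝓡∂ 1)) ((𝓡 p).prod (𝓡∂ 1))
      (fun z : N × EuclideanHalfSpace 1 => ν z.1) V.orientation
      (Q.c' ∘ Prod.map (fun y => y) flip) (x, t) := by
    have h1 : OrientedLocalDiffeoAt ((𝓡 p).prod (𝓡∂ 1)) ((𝓡 p).prod (𝓡∂ 1))
        (fun z : N × EuclideanHalfSpace 1 => ν z.1) (fun z : N × EuclideanHalfSpace 1 => ν' z.1)
        (Prod.map (fun y => y) flip) (x, t) :=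
      ((OrientedLocalDiffeoAt.id ν x).prodMap (x := (x, t))
        (flip_oriented ht0 ht1)).congr_orientation (by simp [hν])
    exact (hc' _).comp h1
  -- After cancelling `Q.c` it remains to see that the transition map composed with `Q.c` agrees
  -- near `(x, t)` with `Q.c'` after the flip.
  refine (hc (x, t)).of_comp (hf.congr_of_eventuallyEq ?_)
  have e1 : ∀ᶠ z in 𝓝 (x, t), Q.c z ∈ Φ.source :=
    Q.emb_left.continuous.continuousAt.eventually (Φ.open_source.mem_nhds hv)
  have hcont : Continuous fun z : N × EuclideanHalfSpace 1 => Q.c' (z.1, flip z.2) :=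
    Q.emb_right.continuous.comp (continuous_fst.prodMk (continuous_flip.comp continuous_snd))
  have e2 : ∀ᶠ z in 𝓝 (x, t), Q.c' (z.1, flip z.2) ∈ Φ'.source :=
    hcont.continuousAt.eventually (Φ'.open_source.mem_nhds hw)
  have e3 : ∀ᶠ z : N × EuclideanHalfSpace 1 in 𝓝 (x, t), z.2.1 0 < 1 :=
    (isOpen_lt (continuous_halfLineCoord.comp continuous_snd) continuous_const).mem_nhds ht1
  filter_upwards [e1, e2, e3] with z h1 h2 h3
  exact h.symm_apply h' h1 h2 (Or.inr (hQ ⟨z.1, z.2, h3.le, rfl, rfl⟩))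

theorem IsParam.oriented {Φ Φ' : OpenPartialHomeomorph V P.Glued} (h : P.IsParam Φ)
    (h' : P.IsParam Φ')
    (hc : ∀ z, OrientedLocalDiffeoAt ((𝓡 p).prod (𝓡∂ 1)) ((𝓡 p).prod (𝓡∂ 1))
      (fun z : N × EuclideanHalfSpace 1 => - N.orientation z.1) V.orientation P.c z)
    (hc' : ∀ z, OrientedLocalDiffeoAt ((𝓡 p).prod (𝓡∂ 1)) ((𝓡 p).prod (𝓡∂ 1))
      (fun z : N × EuclideanHalfSpace 1 => N.orientation z.1) V.orientation P.c' z)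
    {v : V} (hv : v ∈ Φ.source) (hv' : Φ v ∈ Φ'.target) :
    OrientedLocalDiffeoAt ((𝓡 p).prod (𝓡∂ 1)) ((𝓡 p).prod (𝓡∂ 1)) V.orientation V.orientation
      (Φ'.symm ∘ Φ) v := by
  rcases h.rel h' hv hv' with hr | hr | hr
  · refine (OrientedLocalDiffeoAt.id _ _).congr_of_eventuallyEq ?_
    have hw := Φ'.map_target hv'
    rw [← hr] at hw
    filter_upwards [Φ.open_source.mem_nhds hv, Φ'.open_source.mem_nhds hw] with w h1 h2
    exact h.symm_apply h' h1 h2 (Or.inl rfl)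
  · exact h.oriented_of_rel h' Or.inl (ν := fun x => - N.orientation x) (fun x => by simp)
      hc hc' hv hv' hr rfl
  · exact h.oriented_of_rel h' (Q := P.swap) (fun h => Or.inr (P.rel_swap.1 h)) (fun x => rfl)
      hc' hc hv hv' (P.rel_swap.2 hr) P.interior_swap

variable (P)
variable (hc : ∀ z, OrientedLocalDiffeoAt ((𝓡 p).prod (𝓡∂ 1)) ((𝓡 p).prod (𝓡∂ 1))
      (fun z : N × EuclideanHalfSpace 1 => - N.orientation z.1) V.orientation P.c z)
    (hc' : ∀ z, OrientedLocalDiffeoAt ((𝓡 p).prod (𝓡∂ 1)) ((𝓡 p).prod (𝓡∂ 1))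
      (fun z : N × EuclideanHalfSpace 1 => N.orientation z.1) V.orientation P.c' z)

/-- The restrictions of the quotient map as an oriented cover of the glued space. -/
noncomputable def cover : OrientedCover ((𝓡 p).prod (𝓡∂ 1)) V.orientation P.Glued where
  param q := (P.exists_isParam (P.proj_surjective q).choose).choose
  mem_target q := by
    obtain ⟨h, hs⟩ := (P.exists_isParam (P.proj_surjective q).choose).choose_spec
    obtain ⟨_, he⟩ := h _ hs
    rw [← (P.proj_surjective q).choose_spec]
    have := OpenPartialHomeomorph.map_source _ hs
    rw [he] at this
    convert! this using 2
    rw [(P.proj_surjective q).choose_spec]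
  transition q q' _ hv hv' :=
    (P.exists_isParam (P.proj_surjective q).choose).choose_spec.1.oriented
      (P.exists_isParam (P.proj_surjective q').choose).choose_spec.1 hc hc' hv hv'

theorem isParam_cover (q : P.Glued) : P.IsParam ((P.cover hc hc').param q) :=
  (P.exists_isParam (P.proj_surjective q).choose).choose_spec.1

theorem proj_rep (q : P.Glued) :
    ∃ h : (P.cover hc hc').rep q ∈ P.interior, P.proj ⟨(P.cover hc hc').rep q, h⟩ = q := by
  obtain ⟨h, he⟩ := P.isParam_cover hc hc' q _ ((P.cover hc hc').rep_mem q)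
  exact ⟨h, he.symm.trans ((P.cover hc hc').param_rep q)⟩

/-- The glued oriented manifold. -/
noncomputable def gluedManifold : CompactOrientedManifold ((𝓡 p).prod (𝓡∂ 1)) where
  carrier := P.Glued
  charted := (P.cover hc hc').chartedSpace
  smooth := (P.cover hc hc').isManifold
  orientation q := V.orientation ((P.cover hc hc').rep q)
  isOrientation := (P.cover hc hc').isOrientation V.isOrientation

/-- Outside the two collars nothing is identified, so the outer ends of the bordisms can be followed
into the glued manifold. -/
theorem mem_range_of_rel {v w : V} (h : v = w ∨ P.Rel v w ∨ P.Rel w v)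
    (hv : v ∉ Set.range P.c ∪ Set.range P.c') : v = w := by
  rcases h with h | ⟨x, t, -, h, -⟩ | ⟨x, t, -, -, h⟩
  · exact h
  · exact (hv (Or.inl ⟨_, h⟩)).elim
  · exact (hv (Or.inr ⟨_, h⟩)).elim

theorem mem_interior_of_notMem {v : V} (hv : v ∉ Set.range P.c ∪ Set.range P.c') :
    v ∈ P.interior := by
  rintro (⟨x, h⟩ | ⟨x, h⟩)
  · exact hv (Or.inl ⟨_, h⟩)
  · exact hv (Or.inr ⟨_, h⟩)

theorem rep_proj {v : V} (hv : v ∉ Set.range P.c ∪ Set.range P.c') :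
    (P.cover hc hc').rep (P.proj ⟨v, P.mem_interior_of_notMem hv⟩) = v := by
  obtain ⟨h, he⟩ := P.proj_rep hc hc' (P.proj ⟨v, P.mem_interior_of_notMem hv⟩)
  exact (P.mem_range_of_rel ((P.proj_eq_iff.1 he.symm).imp_left (congrArg Subtype.val)) hv).symm

/-- A local diffeomorphism to `V` away from the collars gives one to the glued manifold. -/
theorem proj_comp_oriented {H D : Type*} [TopologicalSpace H] [TopologicalSpace D] [ChartedSpace H D]
    {J : ModelWithCorners ℝ (EuclideanSpace ℝ (Fin p) × EuclideanSpace ℝ (Fin 1)) H}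
    {δ : D → ℤˣ} {d : D → V} (hd : ∀ z, d z ∉ Set.range P.c ∪ Set.range P.c') {z : D}
    (h : OrientedLocalDiffeoAt J ((𝓡 p).prod (𝓡∂ 1)) δ V.orientation d z) :
    OrientedLocalDiffeoAt (N := P.gluedManifold hc hc') J ((𝓡 p).prod (𝓡∂ 1)) δ
      (P.gluedManifold hc hc').orientation
      (fun z => P.proj ⟨d z, P.mem_interior_of_notMem (hd z)⟩) z := by
  set q := P.proj ⟨d z, P.mem_interior_of_notMem (hd z)⟩ with hq
  have hs := (P.cover hc hc').rep_mem q
  rw [hq, P.rep_proj hc hc' (hd z), ← hq] at hs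
  have h1 := OrientedLocalDiffeoAt.comp (P := P.gluedManifold hc hc')
    ((P.cover hc hc').param_oriented q (d z) hs) h
  refine OrientedLocalDiffeoAt.congr_of_eventuallyEq (N := P.gluedManifold hc hc') h1 ?_
  filter_upwards [h.continuousAt.eventually
    (((P.cover hc hc').param q).open_source.mem_nhds hs)] with w hw
  obtain ⟨_, he⟩ := P.isParam_cover hc hc' q _ hw
  exact he.symm

end oriented
end TwoCollars

/-! ### Composition and reversal of bordisms -/

namespace Bordism
variable {p : ℕ} {N₀ N₁ N₂ : CompactOrientedManifold (𝓡 p)}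

theorem isOpenEmbedding_collars (W : Bordism N₀ N₁) :
    Topology.IsOpenEmbedding (Sum.elim W.collar₀ W.collar₁) := by
  have h0 : IsLocalDiffeomorph ((𝓡 p).prod (𝓡∂ 1)) ((𝓡 p).prod (𝓡∂ 1)) ∞ W.collar₀ :=
    fun z => (W.oriented₀ z).1
  have h1 : IsLocalDiffeomorph ((𝓡 p).prod (𝓡∂ 1)) ((𝓡 p).prod (𝓡∂ 1)) ∞ W.collar₁ :=
    fun z => (W.oriented₁ z).1
  exact .of_continuous_injective_isOpenMap
    (h0.contMDiff.continuous.sumElim h1.contMDiff.continuous) W.injective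
    (h0.isOpenMap.sumElim h1.isOpenMap)

/-- The end of the first and the beginning of the second bordism, as collars in the disjoint
union. -/
def middleCollars (W : Bordism N₀ N₁) (W' : Bordism N₁ N₂) :
    TwoCollars N₁ (W.toCompactOrientedManifold.sum W'.toCompactOrientedManifold) where
  c := Sum.inl ∘ W.collar₁
  c' := Sum.inr ∘ W'.collar₀
  emb := by
    have h1 := W.isOpenEmbedding_collars.comp Topology.IsOpenEmbedding.inr
    have h0 := W'.isOpenEmbedding_collars.comp Topology.IsOpenEmbedding.inl
    exact .of_continuous_injective_isOpenMap
      ((continuous_inl.comp h1.continuous).sumElim (continuous_inr.comp h0.continuous))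
      ((Sum.inl_injective.comp h1.injective).sumElim (Sum.inr_injective.comp h0.injective)
        (fun _ _ => Sum.inl_ne_inr))
      ((isOpenMap_inl.comp h1.isOpenMap).sumElim (isOpenMap_inr.comp h0.isOpenMap))

theorem middle_notMem_left (W : Bordism N₀ N₁) (W' : Bordism N₁ N₂)
    (z : N₀ × EuclideanHalfSpace 1) :
    (Sum.inl (W.collar₀ z) : W.carrier ⊕ W'.carrier) ∉
      Set.range (W.middleCollars W').c ∪ Set.range (W.middleCollars W').c' := by
  rintro (⟨z', h⟩ | ⟨z', h⟩)
  · exact Sum.inr_ne_inl (W.injective (a₁ := Sum.inr z') (a₂ := Sum.inl z) (Sum.inl_injective h))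
  · exact Sum.inr_ne_inl h

theorem middle_notMem_right (W : Bordism N₀ N₁) (W' : Bordism N₁ N₂)
    (z : N₂ × EuclideanHalfSpace 1) :
    (Sum.inr (W'.collar₁ z) : W.carrier ⊕ W'.carrier) ∉
      Set.range (W.middleCollars W').c ∪ Set.range (W.middleCollars W').c' := by
  rintro (⟨z', h⟩ | ⟨z', h⟩)
  · exact Sum.inl_ne_inr h
  · exact Sum.inl_ne_inr (W'.injective (a₁ := Sum.inl z') (a₂ := Sum.inr z) (Sum.inr_injective h))

theorem middle_oriented_left (W : Bordism N₀ N₁) (W' : Bordism N₁ N₂)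
    (z : N₁ × EuclideanHalfSpace 1) :
    OrientedLocalDiffeoAt ((𝓡 p).prod (𝓡∂ 1)) ((𝓡 p).prod (𝓡∂ 1))
      (fun z : N₁ × EuclideanHalfSpace 1 => - N₁.orientation z.1)
      (W.toCompactOrientedManifold.sum W'.toCompactOrientedManifold).orientation
      (W.middleCollars W').c z :=
  (OrientedLocalDiffeoAt.inl W.orientation W'.orientation _).comp (W.oriented₁ z)

theorem middle_oriented_right (W : Bordism N₀ N₁) (W' : Bordism N₁ N₂)
    (z : N₁ × EuclideanHalfSpace 1) :
    OrientedLocalDiffeoAt ((𝓡 p).prod (𝓡∂ 1)) ((𝓡 p).prod (𝓡∂ 1))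
      (fun z : N₁ × EuclideanHalfSpace 1 => N₁.orientation z.1)
      (W.toCompactOrientedManifold.sum W'.toCompactOrientedManifold).orientation
      (W.middleCollars W').c' z :=
  (OrientedLocalDiffeoAt.inr W.orientation W'.orientation _).comp (W'.oriented₀ z)

/-- The composition of two bordisms. -/
noncomputable def trans (W : Bordism N₀ N₁) (W' : Bordism N₁ N₂) : Bordism N₀ N₂ where
  toCompactOrientedManifold := (W.middleCollars W').gluedManifold
    (W.middle_oriented_left W') (W.middle_oriented_right W')
  collar₀ z := (W.middleCollars W').proj
    ⟨Sum.inl (W.collar₀ z), TwoCollars.mem_interior_of_notMem _ (W.middle_notMem_left W' z)⟩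
  collar₁ z := (W.middleCollars W').proj
    ⟨Sum.inr (W'.collar₁ z), TwoCollars.mem_interior_of_notMem _ (W.middle_notMem_right W' z)⟩
  oriented₀ z := by
    have h := (OrientedLocalDiffeoAt.inl (I := (𝓡 p).prod (𝓡∂ 1)) W.orientation W'.orientation
      (W.collar₀ z)).comp (W.oriented₀ z)
    exact (W.middleCollars W').proj_comp_oriented (W.middle_oriented_left W')
      (W.middle_oriented_right W') (W.middle_notMem_left W') h
  oriented₁ z := by
    have h := (OrientedLocalDiffeoAt.inr (I := (𝓡 p).prod (𝓡∂ 1)) W.orientation W'.orientation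
      (W'.collar₁ z)).comp (W'.oriented₁ z)
    exact (W.middleCollars W').proj_comp_oriented (W.middle_oriented_left W')
      (W.middle_oriented_right W') (W.middle_notMem_right W') h
  injective := by
    have key : ∀ {v w : (W.middleCollars W').interior},
        (W.middleCollars W').proj v = (W.middleCollars W').proj w →
        v.1 ∉ Set.range (W.middleCollars W').c ∪ Set.range (W.middleCollars W').c' →
        v.1 = w.1 := fun h hv =>
      TwoCollars.mem_range_of_rel _ (((W.middleCollars W').proj_eq_iff.1 h).imp_left
        (congrArg Subtype.val)) hv
    rintro (z | z) (z' | z') h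
    · have h1 := Sum.inl_injective (key h (W.middle_notMem_left W' z))
      exact congrArg Sum.inl (Sum.inl_injective (W.injective (a₁ := Sum.inl z) (a₂ := Sum.inl z') h1))
    · exact (Sum.inl_ne_inr (key h (W.middle_notMem_left W' z))).elim
    · exact (Sum.inr_ne_inl (key h (W.middle_notMem_right W' z))).elim
    · have h1 := Sum.inr_injective (key h (W.middle_notMem_right W' z))
      exact congrArg Sum.inr (Sum.inr_injective (W'.injective (a₁ := Sum.inr z) (a₂ := Sum.inr z') h1))
  boundary_eq := by
    let hc := W.middle_oriented_left W'
    let hc' := W.middle_oriented_right W'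
    have hb : ((𝓡 p).prod (𝓡∂ 1)).boundary (W.carrier ⊕ W'.carrier) = _ :=
      ModelWithCorners.boundary_disjointUnion
    rw [W.boundary_eq, W'.boundary_eq] at hb
    ext q
    refine (((W.middleCollars W').cover hc hc').mem_boundary_iff q).trans ?_
    obtain ⟨hq, hqe⟩ := (W.middleCollars W').proj_rep hc hc' q
    constructor
    · intro h
      have h := hb ▸ h
      -- The disjoint union has four families of ends; the two copies of `N₁` were removed, which
      -- leaves `N₀` and `N₂`.
      rcases h with ⟨_, ⟨x, rfl⟩ | ⟨x, rfl⟩, h⟩ | ⟨_, ⟨x, rfl⟩ | ⟨x, rfl⟩, h⟩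
      · refine Or.inl ⟨x, Eq.trans (congrArg _ (Subtype.ext h)) hqe⟩
      · exact (hq (Or.inl ⟨x, h⟩)).elim
      · exact (hq (Or.inr ⟨x, h⟩)).elim
      · refine Or.inr ⟨x, Eq.trans (congrArg _ (Subtype.ext h)) hqe⟩
    · rintro (⟨x, rfl⟩ | ⟨x, rfl⟩)
      · have h := (W.middleCollars W').rep_proj hc hc' (W.middle_notMem_left W' (x, 0))
        refine (congrArg (· ∈ ((𝓡 p).prod (𝓡∂ 1)).boundary (W.carrier ⊕ W'.carrier)) h).mpr ?_
        rw [hb]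
        exact Or.inl ⟨_, Or.inl ⟨x, rfl⟩, rfl⟩
      · have h := (W.middleCollars W').rep_proj hc hc' (W.middle_notMem_right W' (x, 0))
        refine (congrArg (· ∈ ((𝓡 p).prod (𝓡∂ 1)).boundary (W.carrier ⊕ W'.carrier)) h).mpr ?_
        rw [hb]
        exact Or.inr ⟨_, Or.inr ⟨x, rfl⟩, rfl⟩

/-- The bordism read backwards. -/
noncomputable def symm (W : Bordism N₀ N₁) : Bordism N₁ N₀ where
  toCompactOrientedManifold := W.toCompactOrientedManifold.neg
  collar₀ := W.collar₁
  collar₁ := W.collar₀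
  oriented₀ z := (W.oriented₁ z).congr_orientation (by simp [CompactOrientedManifold.neg])
  oriented₁ z := (W.oriented₀ z).congr_orientation (by simp [CompactOrientedManifold.neg])
  injective := by
    have h := W.injective.comp (Equiv.sumComm _ _).injective
    convert! h using 1
    ext (z | z) <;> rfl
  boundary_eq := W.boundary_eq.trans (Set.union_comm _ _)

end Bordism

/-! ### Bordism is an equivalence relation, invariant under homotopy -/

namespace Bordant
variable {p : ℕ} {A B : Type*} [TopologicalSpace A] [TopologicalSpace B]
  {s t r : SingularClosedManifold p A}

theorem refl (s : SingularClosedManifold p A) : Bordant s s := IsAdditiveRelation.bordant.refl s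

theorem symm : Bordant s t → Bordant t s := by
  rintro ⟨W, h, h0, h1⟩
  exact ⟨W.symm, h, h1, h0⟩

theorem trans : Bordant s t → Bordant t r → Bordant s r := by
  rintro ⟨W, h, h0, h1⟩ ⟨W', h', h0', h1'⟩
  let k : C(W.carrier ⊕ W'.carrier, A) :=
    ⟨Sum.elim h h', h.continuous.sumElim h'.continuous⟩
  -- The maps on the two bordisms agree on `N₁`, which is what `descend` requires; the outer ends
  -- lie off the middle collars and are not moved by the collapse.
  let d : C((W.trans W').carrier, A) :=
    (W.middleCollars W').descend k fun x => (h1 x).trans (h0' x).symm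
  refine ⟨W.trans W', d, ?_, ?_⟩
  · intro x
    refine Eq.trans (congrArg k ((W.middleCollars W').collapseMap_of_notMem ?_ ?_)) (h0 x)
    · exact fun z hz => W.middle_notMem_left W' (x, 0) (Or.inl ⟨z, hz⟩)
    · exact fun z hz => W.middle_notMem_left W' (x, 0) (Or.inr ⟨z, hz⟩)
  · intro x
    refine Eq.trans (congrArg k ((W.middleCollars W').collapseMap_of_notMem ?_ ?_)) (h1' x)
    · exact fun z hz => W.middle_notMem_right W' (x, 0) (Or.inl ⟨z, hz⟩)
    · exact fun z hz => W.middle_notMem_right W' (x, 0) (Or.inr ⟨z, hz⟩)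

theorem push (e : C(A, B)) : Bordant s t → Bordant (s.push e) (t.push e) := by
  rintro ⟨W, h, h0, h1⟩
  exact ⟨W, e.comp h, fun x => congrArg e (h0 x), fun x => congrArg e (h1 x)⟩

/-- The homotopy composed with `s` is a map on the cylinder over the source of `s`. -/
theorem of_homotopic {e e' : C(A, B)} (h : e.Homotopic e') (s : SingularClosedManifold p A) :
    Bordant (s.push e) (s.push e') := by
  obtain ⟨K⟩ := h
  let W := Bordism.cylinder s.toCompactOrientedManifold s.toCompactOrientedManifold (fun x => x)
    Function.bijective_id (OrientedLocalDiffeoAt.id _)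
  refine ⟨W, ⟨fun z : s.carrier × Set.Icc (0 : ℝ) 1 => K (z.2, s.map z.1), ?_⟩, ?_, ?_⟩
  · exact K.continuous.comp (continuous_snd.prodMk (s.map.continuous.comp continuous_fst))
  · intro x
    change K (collarParam 0, s.map x) = e (s.map x)
    rw [Bordism.collarParam_zero]
    exact K.apply_zero _
  · intro x
    change K (unitInterval.symm (collarParam 0), s.map x) = e' (s.map x)
    rw [Bordism.collarParam_zero, unitInterval.symm_zero]
    exact K.apply_one _

end Bordant

/-! ### Concatenation of families of paths -/

section join
open unitInterval
variable {A Z : Type*} [TopologicalSpace A] [TopologicalSpace Z]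

/-- `t ↦ t / 2`. -/
noncomputable def lowerHalf (t : I) : I :=
  ⟨t / 2, by linarith [t.2.1], by linarith [t.2.2]⟩

/-- `t ↦ (1 + t) / 2`. -/
noncomputable def upperHalf (t : I) : I :=
  ⟨(1 + t) / 2, by linarith [t.2.1], by linarith [t.2.2]⟩

theorem continuous_lowerHalf : Continuous lowerHalf := by unfold lowerHalf; fun_prop

theorem continuous_upperHalf : Continuous upperHalf := by unfold upperHalf; fun_prop

theorem lowerHalf_zero : lowerHalf 0 = 0 := Subtype.ext (by simp [lowerHalf])

theorem upperHalf_one : upperHalf 1 = 1 := Subtype.ext (by simp [upperHalf])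

theorem lowerHalf_one : lowerHalf 1 = upperHalf 0 :=
  Subtype.ext (by simp [lowerHalf, upperHalf])

/-- Two families of paths, one after the other. -/
noncomputable def joinFun {A Z : Type*} (P Q : A × I → Z) (z : A × I) : Z :=
  if (z.2 : ℝ) ≤ 1 / 2 then P (z.1, Set.projIcc 0 1 zero_le_one (2 * z.2))
    else Q (z.1, Set.projIcc 0 1 zero_le_one (2 * z.2 - 1))

/-- Formulated for bare functions, so that paths from families over different parameter spaces can
be compared half by half. -/
theorem joinFun_congr {A B Z : Type*} {P Q : A × I → Z} {P' Q' : B × I → Z} {a : A} {b : B}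
    (hP : ∀ t, P (a, t) = P' (b, t)) (hQ : ∀ t, Q (a, t) = Q' (b, t)) (t : I) :
    joinFun P Q (a, t) = joinFun P' Q' (b, t) := by
  simp only [joinFun, hP, hQ]

theorem joinFun_eq_of_const {A Z : Type*} {P Q : A × I → Z} {a : A} {z : Z}
    (hP : ∀ t, P (a, t) = z) (hQ : ∀ t, Q (a, t) = z) (t : I) : joinFun P Q (a, t) = z := by
  simp only [joinFun, hP, hQ, ite_self]

/-- Two families of paths that fit together, one after the other. -/
noncomputable def join (P Q : C(A × I, Z)) (h : ∀ a, P (a, 1) = Q (a, 0)) : C(A × I, Z) where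
  toFun := joinFun P Q
  continuous_toFun := by
    refine Continuous.if_le ?_ ?_ (by fun_prop) continuous_const ?_
    · exact P.continuous.comp (continuous_fst.prodMk (continuous_projIcc.comp (by fun_prop)))
    · exact Q.continuous.comp (continuous_fst.prodMk (continuous_projIcc.comp (by fun_prop)))
    · rintro ⟨a, t⟩ ht
      have ht : (t : ℝ) = 1 / 2 := ht
      have h1 : Set.projIcc (0 : ℝ) 1 zero_le_one (2 * t) = 1 := by
        rw [ht]; norm_num
      have h2 : Set.projIcc (0 : ℝ) 1 zero_le_one (2 * t - 1) = 0 := by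
        rw [ht]; norm_num
      change P (a, Set.projIcc 0 1 zero_le_one (2 * t)) =
        Q (a, Set.projIcc 0 1 zero_le_one (2 * t - 1))
      rw [h1, h2, h]

variable (P Q : C(A × I, Z)) (h : ∀ a, P (a, 1) = Q (a, 0))

theorem join_lowerHalf (a : A) (t : I) : join P Q h (a, lowerHalf t) = P (a, t) := by
  have h1 : (lowerHalf t : ℝ) ≤ 1 / 2 := by
    change (t : ℝ) / 2 ≤ 1 / 2
    linarith [t.2.2]
  refine (if_pos h1).trans ?_
  have h2 : 2 * (lowerHalf t : ℝ) = t := by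
    change 2 * ((t : ℝ) / 2) = t
    ring
  change P (a, Set.projIcc 0 1 zero_le_one (2 * (lowerHalf t : ℝ))) = _
  rw [h2, Set.projIcc_val]

theorem join_upperHalf (a : A) (t : I) : join P Q h (a, upperHalf t) = Q (a, t) := by
  by_cases ht : t = 0
  · rw [ht, ← lowerHalf_one, join_lowerHalf, h]
  have h1 : ¬ ((upperHalf t : ℝ) ≤ 1 / 2) := by
    change ¬ ((1 + (t : ℝ)) / 2 ≤ 1 / 2)
    have : 0 < (t : ℝ) := unitInterval.pos_iff_ne_zero.2 ht
    linarith
  refine (if_neg h1).trans ?_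
  have h2 : 2 * (upperHalf t : ℝ) - 1 = t := by
    change 2 * ((1 + (t : ℝ)) / 2) - 1 = t
    ring
  change Q (a, Set.projIcc 0 1 zero_le_one (2 * (upperHalf t : ℝ) - 1)) = _
  rw [h2, Set.projIcc_val]

theorem join_zero (a : A) : join P Q h (a, 0) = P (a, 0) := by
  rw [← join_lowerHalf P Q h, lowerHalf_zero]

theorem join_one (a : A) : join P Q h (a, 1) = Q (a, 1) := by
  rw [← join_upperHalf P Q h, upperHalf_one]

end join

universe v w

/-! ### Homotopy fibres and injectivity of induced homomorphisms -/

section fiber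
open unitInterval
variable {X : Type u} {U : Type v} {Z : Type w} [TopologicalSpace X] [TopologicalSpace U]
  [TopologicalSpace Z] {p : ℕ} {Y : Set Z}

theorem HomotopyFiber.ext {f : C(X, Z)} {a b : HomotopyFiber f Y} (h1 : a.1.1 = b.1.1)
    (h2 : ∀ t, a.1.2.1 t = b.1.2.1 t) (h3 : (a.1.2.2 : Z) = b.1.2.2) : a = b :=
  Subtype.ext (Prod.ext h1 (Prod.ext (ContinuousMap.ext h2) (Subtype.ext h3)))

/-- A map to the homotopy fiber, given by its three components, the path in two parts. -/
noncomputable def HomotopyFiber.lift {A : Type*} [TopologicalSpace A] (f : C(X, Z)) (x : C(A, X))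
    (P Q : C(A × I, Z)) (y : C(A, Y)) (h₀ : ∀ a, P (a, 0) = f (x a))
    (h : ∀ a, P (a, 1) = Q (a, 0)) (h₁ : ∀ a, Q (a, 1) = y a) : C(A, HomotopyFiber f Y) where
  toFun a := ⟨(x a, (join P Q h).curry a, y a), (join_zero P Q h a).trans (h₀ a),
    (join_one P Q h a).trans (h₁ a)⟩
  continuous_toFun := Continuous.subtype_mk
    (x.continuous.prodMk ((join P Q h).curry.continuous.prodMk y.continuous)) _

/-- The map of homotopy fibers given by a right homotopy inverse `l` of `k`. -/
noncomputable def HomotopyFiber.retract (Y : Set Z) (g : C(U, Z)) (k : C(X, U)) (l : C(U, X))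
    (M : (k.comp l).Homotopy (ContinuousMap.id U)) :
    C(HomotopyFiber g Y, HomotopyFiber (g.comp k) Y) := by
  have hc : Continuous fun e : HomotopyFiber g Y => e.1 := continuous_subtype_val
  refine HomotopyFiber.lift (g.comp k) (l.comp ⟨fun e => e.1.1, continuous_fst.comp hc⟩)
    ⟨fun z => g (M (z.2, z.1.1.1)), ?_⟩ ⟨fun z => z.1.1.2.1 z.2, ?_⟩
    ⟨fun e => e.1.2.2, (continuous_snd.comp continuous_snd).comp hc⟩ ?_ ?_ ?_
  · exact g.continuous.comp (M.continuous.comp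
      (continuous_snd.prodMk (continuous_fst.comp (hc.comp continuous_fst))))
  · exact ContinuousEval.continuous_eval.comp
      (((continuous_fst.comp continuous_snd).comp (hc.comp continuous_fst)).prodMk continuous_snd)
  · exact fun e => congrArg g (M.apply_zero _)
  · exact fun e => (congrArg g (M.apply_one _)).trans e.2.1.symm
  · exact fun e => e.2.2

theorem equivalence_nielsenEquiv (f : C(X, Z)) (Y : Set Z) :
    Equivalence (NielsenEquiv (p := p) f Y) where
  refl s := (nielsenEquiv_iff f Y s s).2 (Bordant.refl _)
  symm h := (nielsenEquiv_iff f Y _ _).2 ((nielsenEquiv_iff f Y _ _).1 h).symm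
  trans h h' := (nielsenEquiv_iff f Y _ _).2
    (((nielsenEquiv_iff f Y _ _).1 h).trans ((nielsenEquiv_iff f Y _ _).1 h'))

/-- Equality in the quotient means the generated equivalence relation; transitivity of bordism
reduces it to a single bordism in the homotopy fibre. -/
theorem nielsenClass_eq_iff {f : C(X, Z)} {s t : SingularClosedManifold p (f ⁻¹' Y)} :
    nielsenClass s = nielsenClass t ↔
      Bordant (s.push (toHomotopyFiber f Y)) (t.push (toHomotopyFiber f Y)) := by
  rw [← nielsenEquiv_iff]
  exact Quot.eq.trans (equivalence_nielsenEquiv f Y).eqvGen_iff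

/-- The composite enters as a separate map `m`, so that different factorisations of one map can be
compared without transporting classes along equalities of maps to `Z`. -/
theorem inducedHom_comp_apply {V : Type*} [TopologicalSpace V] {f : C(X, Z)} {g : C(U, Z)}
    {e : C(V, Z)} {k : C(X, U)} {l : C(U, V)} (hk : g.comp k = f) (hl : e.comp l = g)
    (z : PreNielsenGroup f Y p) {m : C(X, V)} (hm : l.comp k = m) (hm' : e.comp m = f) :
    inducedHom l hl Y p (inducedHom k hk Y p z) = inducedHom m hm' Y p z := by
  subst hm
  obtain ⟨s⟩ := z
  rfl

theorem inducedHom_id_apply {f : C(X, Z)} {k : C(X, X)} (hk : f.comp k = f)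
    (h : k = ContinuousMap.id X) (z : PreNielsenGroup f Y p) : inducedHom k hk Y p z = z := by
  subst h
  obtain ⟨s⟩ := z
  rfl

/-- If `k s` and `k t` are bordant in the homotopy fibre of `g`, then `retract` carries the bordism
to the homotopy fibre of `g k`. By `h` its ends are bordant there to `s` and `t` with constant
paths. -/
theorem inducedHom_injective_of_retract {g : C(U, Z)} {k : C(X, U)} {l : C(U, X)}
    (M : (k.comp l).Homotopy (ContinuousMap.id U))
    (h : (((HomotopyFiber.retract Y g k l M).comp (toHomotopyFiber g Y)).comp
      (preimageMap k rfl Y)).Homotopic (toHomotopyFiber (g.comp k) Y)) :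
    Function.Injective (inducedHom k rfl Y p : PreNielsenGroup (g.comp k) Y p →+ _) := by
  rintro ⟨s⟩ ⟨t⟩ hst
  have h1 : Bordant _ _ := (nielsenClass_eq_iff (p := p)).1 hst
  have h2 := h1.push (HomotopyFiber.retract Y g k l M)
  exact nielsenClass_eq_iff.2
    (((Bordant.of_homotopic h s).symm.trans h2).trans (Bordant.of_homotopic h t))

/-- With `l = id` the composite to be deformed takes `x` to `m x` with the path `g M(·, m x)`. While
the base point moves along `M` from `m x` to `x`, its trace is added to the path so that the end
stays at `g (m x)`; the result is a path out and back, which contracts. -/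
theorem inducedHom_injective_of_homotopic_id (g : C(U, Z)) {m : C(U, U)}
    (hm : m.Homotopic (ContinuousMap.id U)) :
    Function.Injective (inducedHom m rfl Y p : PreNielsenGroup (g.comp m) Y p →+ _) := by
  obtain ⟨M⟩ := hm
  refine inducedHom_injective_of_retract (l := ContinuousMap.id U) M ?_
  let C := (g.comp m) ⁻¹' Y
  let y : C(I × C, Y) := (restrictToPreimage (g.comp m) Y).comp ⟨Prod.snd, continuous_snd⟩
  -- At time `s` the base point is `M(s, x)`; the path follows `g M(·, M(s, x))` to `g M(s, x)` and
  -- then returns along `g M(·, x)` to `g (m x)`.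
  let H₁ : C(I × C, HomotopyFiber (g.comp m) Y) := HomotopyFiber.lift (g.comp m)
    ⟨fun z => M (z.1, z.2), by fun_prop⟩
    ⟨fun z => g (M (z.2, M (z.1.1, z.1.2))), by fun_prop⟩
    ⟨fun z => g (M (z.1.1 * σ z.2, z.1.2)), by fun_prop⟩ y
    (fun z => congrArg g (M.apply_zero _))
    (fun z => by
      change g (M (1, M (z.1, z.2))) = g (M (z.1 * σ 0, z.2))
      rw [M.apply_one, unitInterval.symm_zero, mul_one]; rfl)
    (fun z => by
      change g (M (z.1 * σ 1, z.2)) = g (m z.2)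
      rw [unitInterval.symm_one, mul_zero, M.apply_zero])
  -- The base point stays at `x`; the path goes along `g M(·, x)` up to time `s` and back, hence is
  -- constant for `s = 0`.
  let H₂ : C(I × C, HomotopyFiber (g.comp m) Y) := HomotopyFiber.lift (g.comp m)
    ⟨fun z => z.2, by fun_prop⟩
    ⟨fun z => g (M (z.1.1 * z.2, z.1.2)), by fun_prop⟩
    ⟨fun z => g (M (z.1.1 * σ z.2, z.1.2)), by fun_prop⟩ y
    (fun z => by
      change g (M (z.1 * 0, z.2)) = g (m z.2)
      rw [mul_zero, M.apply_zero])
    (fun z => by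
      change g (M (z.1 * 1, z.2)) = g (M (z.1 * σ 0, z.2))
      rw [unitInterval.symm_zero])
    (fun z => by
      change g (M (z.1 * σ 1, z.2)) = g (m z.2)
      rw [unitInterval.symm_one, mul_zero, M.apply_zero])
  let e : C(C, HomotopyFiber (g.comp m) Y) := ⟨fun x => H₂ (1, x), by fun_prop⟩
  have h₁ : (((HomotopyFiber.retract Y g m (ContinuousMap.id U) M).comp
      (toHomotopyFiber g Y)).comp (preimageMap m rfl Y)).Homotopic e := by
    refine ⟨⟨H₁, fun x => ?_, fun x => ?_⟩⟩
    · refine HomotopyFiber.ext (M.apply_zero _) (fun t => ?_) rfl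
      refine joinFun_congr (fun t => ?_) (fun t => ?_) t
      · change g (M (t, M (0, x))) = g (M (t, m x))
        rw [M.apply_zero]
      · change g (M (0 * σ t, x)) = g (m x)
        rw [zero_mul, M.apply_zero]
    · refine HomotopyFiber.ext (M.apply_one _) (fun t => ?_) rfl
      refine joinFun_congr (fun t => ?_) (fun t => rfl) t
      change g (M (t, M (1, x))) = g (M (1 * t, x))
      rw [M.apply_one, one_mul]; rfl
  have h₂ : (toHomotopyFiber (g.comp m) Y).Homotopic e := by
    refine ⟨⟨H₂, fun x => ?_, fun x => rfl⟩⟩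
    refine HomotopyFiber.ext rfl (fun t => ?_) rfl
    refine joinFun_eq_of_const (fun t => ?_) (fun t => ?_) t
    · change g (M (0 * t, x)) = g (m x)
      rw [zero_mul, M.apply_zero]
    · change g (M (0 * σ t, x)) = g (m x)
      rw [zero_mul, M.apply_zero]
  exact h₁.trans h₂.symm

/-- `(t, x) ↦ ((1 + t) / 2, x)`. -/
noncomputable def upperInclusion (X : Type u) [TopologicalSpace X] : C(I × X, I × X) :=
  ⟨fun z => (upperHalf z.1, z.2), (continuous_upperHalf.comp continuous_fst).prodMk continuous_snd⟩

/-- `(t, x) ↦ (t / 2, x)`. -/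
noncomputable def lowerInclusion (X : Type u) [TopologicalSpace X] : C(I × X, I × X) :=
  ⟨fun z => (lowerHalf z.1, z.2), (continuous_lowerHalf.comp continuous_fst).prodMk continuous_snd⟩

/-- The upper half of the cylinder is a strong deformation retract. The deformation need not respect
`F`: the paths in the homotopy fibre record the change, and over the upper half they are constant.
-/
theorem inducedHom_upperInclusion_injective (F : C(I × X, Z)) :
    Function.Injective (inducedHom (upperInclusion X) rfl Y p :
      PreNielsenGroup (F.comp (upperInclusion X)) Y p →+ _) := by
  let l : C(I × X, I × X) :=
    ⟨fun z => (Set.projIcc 0 1 zero_le_one (2 * (z.1 : ℝ) - 1), z.2),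
      (continuous_projIcc.comp (by fun_prop)).prodMk continuous_snd⟩
  have hl : ∀ t : I, Set.projIcc (0 : ℝ) 1 zero_le_one (2 * (upperHalf t : ℝ) - 1) = t := by
    intro t
    have h2 : 2 * (upperHalf t : ℝ) - 1 = t := by
      change 2 * ((1 + (t : ℝ)) / 2) - 1 = t
      ring
    rw [h2, Set.projIcc_val]
  -- The first coordinate is `max t ((1 - s) / 2)`: it is `max t (1 / 2)` at `s = 0`, equals `t` at
  -- `s = 1`, and never moves `t ≥ 1 / 2`.
  let M : ((upperInclusion X).comp l).Homotopy (ContinuousMap.id (I × X)) :=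
    { toFun := fun z => (max z.2.1 (lowerHalf (σ z.1)), z.2.2)
      continuous_toFun := (Continuous.max (by fun_prop)
        (continuous_lowerHalf.comp (by fun_prop))).prodMk (by fun_prop)
      map_zero_left := by
        rintro ⟨t, x⟩
        refine Prod.ext (Subtype.ext ?_) rfl
        change max t (lowerHalf (σ 0)) = (1 + max 0 (min 1 (2 * (t : ℝ) - 1))) / 2
        rw [unitInterval.symm_zero]
        change max (t : ℝ) (1 / 2) = _
        rw [min_eq_right (by linarith [t.2.2])]
        rcases le_total (t : ℝ) (1 / 2) with h | h
        · rw [max_eq_right h, max_eq_left (by linarith)]; ring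
        · rw [max_eq_left h, max_eq_right (by linarith)]; ring
      map_one_left := by
        rintro ⟨t, x⟩
        refine Prod.ext ?_ rfl
        change max t (lowerHalf (σ 1)) = t
        rw [unitInterval.symm_one, lowerHalf_zero]
        exact max_eq_left t.2.1 }
  have hM : ∀ (s t : I) (x : X), M (s, (upperHalf t, x)) = (upperHalf t, x) := by
    intro s t x
    refine Prod.ext ?_ rfl
    refine max_eq_left ?_
    change (1 - (s : ℝ)) / 2 ≤ (1 + (t : ℝ)) / 2
    linarith [s.2.1, t.2.1]
  refine inducedHom_injective_of_retract M ?_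
  refine (ContinuousMap.ext fun x => ?_ : _ = toHomotopyFiber (F.comp (upperInclusion X)) Y) ▸
    ContinuousMap.Homotopic.refl _
  refine HomotopyFiber.ext (Prod.ext (hl _) rfl) (fun t => ?_) rfl
  refine joinFun_eq_of_const (fun t => ?_) (fun t => rfl) t
  exact congrArg F (hM t x.1.1 x.1.2)

/-! ### The Nielsen subgroup and homotopy equivalences -/

theorem mem_nielsenSubgroup {f : C(X, Z)} {z : PreNielsenGroup f Y p} :
    z ∈ nielsenSubgroup f Y p ↔ ∀ (F : C(I × X, Z)) (hF : F.comp (slice X 0) = f),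
      ∃ w : PreNielsenGroup (F.comp (slice X 1)) Y p,
        inducedHom (slice X 1) rfl Y p w = inducedHom (slice X 0) hF Y p z := by
  simp only [nielsenSubgroup, AddSubgroup.mem_iInf, AddSubgroup.mem_comap, AddMonoidHom.mem_range]

/-- A homotopy `G` of `g` pulls back to the homotopy `G ∘ (id × k)` of `f`, which preserves `z`. The
map `id × k` commutes with the inclusions of both ends, so the image under `k` of a witness for `z`
is a witness for the image of `z`. -/
theorem inducedHom_mem_nielsenSubgroup {f : C(X, Z)} {g : C(U, Z)} {k : C(X, U)}
    (hk : g.comp k = f) {z : PreNielsenGroup f Y p} (hz : z ∈ nielsenSubgroup f Y p) :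
    inducedHom k hk Y p z ∈ nielsenSubgroup g Y p := by
  rw [mem_nielsenSubgroup] at hz ⊢
  intro G hG
  let j : C(I × X, I × U) := (ContinuousMap.id I).prodMap k
  obtain ⟨w, hw⟩ := hz (G.comp j) (by rw [← hk, ← hG]; rfl)
  have h₀ : G.comp ((slice U 0).comp k) = f := by rw [← hk, ← hG]; rfl
  exact ⟨inducedHom k rfl Y p w,
    ((inducedHom_comp_apply (k := k) (l := slice U 1) _ _ w rfl rfl).trans
      (inducedHom_comp_apply (k := slice X 1) (l := j) _ rfl w rfl rfl).symm).trans
    ((congrArg (inducedHom j rfl Y p) hw).trans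
      ((inducedHom_comp_apply (k := slice X 0) (l := j) _ rfl z rfl h₀).trans
        (inducedHom_comp_apply (k := k) (l := slice U 0) _ _ z rfl h₀).symm))⟩

/-- This is where being preserved by all homotopies is used: the homotopy `g K` produces `v`, and
its continuations show that `v` is itself preserved. -/
theorem exists_mem_nielsenSubgroup_of_homotopy {g : C(U, Z)} {w : PreNielsenGroup g Y p}
    (hw : w ∈ nielsenSubgroup g Y p) {m : C(U, U)} (hm : (ContinuousMap.id U).Homotopic m) :
    ∃ v ∈ nielsenSubgroup (g.comp m) Y p, inducedHom m rfl Y p v = w := by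
  obtain ⟨K₀⟩ := hm
  obtain ⟨K, hK0, rfl⟩ : ∃ K : C(I × U, U), K.comp (slice U 0) = ContinuousMap.id U ∧
      K.comp (slice U 1) = m :=
    ⟨K₀.toContinuousMap, ContinuousMap.ext K₀.apply_zero, ContinuousMap.ext K₀.apply_one⟩
  clear K₀
  rw [mem_nielsenSubgroup] at hw
  have hG0 : (g.comp K).comp (slice U 0) = g :=
    ContinuousMap.ext fun x => congrArg g (DFunLike.congr_fun hK0 x)
  obtain ⟨v, hv⟩ := hw (g.comp K) hG0
  refine ⟨v, ?_, ?_⟩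
  · rw [mem_nielsenSubgroup]
    intro H hH
    have hj : ∀ x : U, (g.comp K).comp ContinuousMap.prodSwap (x, (1 : I)) =
        H.comp ContinuousMap.prodSwap (x, 0) := fun x => (DFunLike.congr_fun hH x).symm
    -- `F` is `g K` followed by `H`, again a homotopy of `g`, so that `w` is preserved by it.
    let F : C(I × U, Z) := (join _ _ hj).comp ContinuousMap.prodSwap
    have hF0 : F.comp (slice U 0) = g :=
      ContinuousMap.ext fun x => (join_zero _ _ hj x).trans (DFunLike.congr_fun hG0 x)
    have hFl : F.comp (lowerInclusion U) = g.comp K :=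
      ContinuousMap.ext fun z => join_lowerHalf _ _ hj z.2 z.1
    have hFu : F.comp (upperInclusion U) = H :=
      ContinuousMap.ext fun z => join_upperHalf _ _ hj z.2 z.1
    clear_value F
    have hu1 : (upperInclusion U).comp (slice U 1) = slice U 1 :=
      ContinuousMap.ext fun x => Prod.ext upperHalf_one rfl
    have hl0 : (lowerInclusion U).comp (slice U 0) = slice U 0 :=
      ContinuousMap.ext fun x => Prod.ext lowerHalf_zero rfl
    have hl1 : (lowerInclusion U).comp (slice U 1) = (upperInclusion U).comp (slice U 0) :=
      ContinuousMap.ext fun x => Prod.ext lowerHalf_one rfl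
    obtain ⟨a, ha⟩ := hw F hF0
    subst hFu
    -- Pushed into the whole cylinder, the equation for `v` says that `v` at the middle level equals
    -- `w` at the beginning, and hence equals `a` at the end.
    have h1 := congrArg (inducedHom (lowerInclusion U) hFl Y p) hv
    rw [inducedHom_comp_apply _ _ _ hl1
        (by rw [← ContinuousMap.comp_assoc, hH]; rfl),
      inducedHom_comp_apply _ _ _ hl0 hF0, ← ha] at h1
    have hFe : (F.comp (upperInclusion U)).comp (slice U 1) = F.comp (slice U 1) := by
      rw [ContinuousMap.comp_assoc, hu1]
    -- The two descriptions of the final map of the homotopy are equal but not by definition; the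
    -- identity of `U` carries `a` from one group to the other.
    refine ⟨inducedHom (ContinuousMap.id U) ((ContinuousMap.comp_id _).trans hFe) Y p a, ?_⟩
    apply inducedHom_upperInclusion_injective F
    rw [inducedHom_comp_apply _ _ a (ContinuousMap.comp_id _) hFe,
      inducedHom_comp_apply _ _ a hu1 rfl,
      inducedHom_comp_apply _ _ _ rfl (by rw [← ContinuousMap.comp_assoc, hH]), h1]
  -- `K` is a morphism from `g K` to `g` that restricts to the identity at time `0` and to `m` at
  -- time `1`.
  · have h := congrArg (inducedHom K (g := g) rfl Y p) hv
    rw [inducedHom_comp_apply _ _ _ rfl rfl, inducedHom_comp_apply _ _ _ hK0 (ContinuousMap.comp_id g),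
      inducedHom_id_apply _ rfl] at h
    exact h

/-- The homomorphism of Nielsen groups induced by `k`. -/
noncomputable def nielsenHom {f : C(X, Z)} {g : C(U, Z)} (k : C(X, U)) (hk : g.comp k = f)
    (Y : Set Z) (p : ℕ) : nielsenSubgroup f Y p →+ nielsenSubgroup g Y p :=
  ((inducedHom k hk Y p).comp (nielsenSubgroup f Y p).subtype).codRestrict _
    fun z => inducedHom_mem_nielsenSubgroup hk z.2

theorem nielsenHom_bijective {f : C(X, Z)} {g : C(U, Z)} (e : ContinuousMap.HomotopyEquiv X U)
    (hk : g.comp e.toFun = f) : Function.Bijective (nielsenHom e.toFun hk Y p) := by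
  subst hk
  obtain ⟨k, l, hlk, hkl⟩ := e
  constructor
  · rw [injective_iff_map_eq_zero]
    rintro ⟨z, hz⟩ h
    have h : inducedHom k rfl Y p z = 0 := congrArg Subtype.val h
    -- Membership of `z` in the Nielsen subgroup makes it factor as `(l k)_* v`; the kernel can then
    -- be tested on `k_* v`, where `k l ≃ id` applies.
    obtain ⟨v, -, hv⟩ := exists_mem_nielsenSubgroup_of_homotopy hz hlk.symm
    let a : PreNielsenGroup (g.comp (k.comp l)) Y p := inducedHom k rfl Y p v
    have h1 : inducedHom (k.comp l) (g := g) rfl Y p a = 0 := by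
      rw [← h, ← hv]
      exact (inducedHom_comp_apply (k := k) (l := k.comp l) (m := (k.comp l).comp k)
        _ _ v rfl rfl).trans
          (inducedHom_comp_apply (k := l.comp k) (l := k) _ _ v rfl rfl).symm
    have h2 : a = 0 := inducedHom_injective_of_homotopic_id g hkl (h1.trans (map_zero _).symm)
    have h3 : inducedHom l (g := g.comp k) (f := g.comp (k.comp l)) rfl Y p a = z :=
      (inducedHom_comp_apply _ _ v rfl rfl).trans hv
    rw [h2, map_zero] at h3
    exact Subtype.ext h3.symm
  · rintro ⟨w, hw⟩
    -- The preimage of `w = (k l)_* v` is `l_* v`; it lies in the Nielsen subgroup because `v` does.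
    obtain ⟨v, hv, hvw⟩ := exists_mem_nielsenSubgroup_of_homotopy hw hkl.symm
    refine ⟨⟨inducedHom l (g := g.comp k) (f := g.comp (k.comp l)) rfl Y p v,
      inducedHom_mem_nielsenSubgroup _ hv⟩, Subtype.ext ?_⟩
    exact (inducedHom_comp_apply _ _ v rfl rfl).trans hvw

theorem bordismIndex_inducedHom {f : C(X, Z)} {g : C(U, Z)} {k : C(X, U)} (hk : g.comp k = f)
    (z : PreNielsenGroup f Y p) :
    bordismIndex g Y p (inducedHom k hk Y p z) = bordismIndex f Y p z := by
  subst hk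
  obtain ⟨s⟩ := z
  rfl

/-- The homomorphism of algebraic Nielsen groups induced by `k`. -/
noncomputable def algNielsenHom {f : C(X, Z)} {g : C(U, Z)} (k : C(X, U)) (hk : g.comp k = f)
    (Y : Set Z) (p : ℕ) : AlgNielsenGroup f Y p →+ AlgNielsenGroup g Y p :=
  QuotientAddGroup.map _ _ (inducedHom k hk Y p) fun z hz => by
    rw [AddSubgroup.mem_comap, AddMonoidHom.mem_ker, bordismIndex_inducedHom]
    exact hz

end fiber

/-! ### The three functors -/

section functors
variable {Z : TopCat.{u}} (Y : Set Z)

/-- The functor `S'_*`. -/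
noncomputable def preNielsenFunctor : FunctorOn (preNielsenObj Y) where
  map k p := AddCommGrpCat.ofHom (inducedHom (morphismMap k) (problemMap_comp k) Y p)
  map_id P := by
    funext p
    ext z
    exact inducedHom_id_apply _ rfl z
  map_comp k l := by
    funext p
    ext z
    exact (inducedHom_comp_apply _ _ z rfl _).symm

/-- The functor `S_*`. -/
noncomputable def nielsenFunctor : FunctorOn (nielsenObj Y) where
  map k p := AddCommGrpCat.ofHom (nielsenHom (morphismMap k) (problemMap_comp k) Y p)
  map_id P := by
    funext p
    ext z
    exact inducedHom_id_apply _ rfl z.1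
  map_comp k l := by
    funext p
    ext z
    exact (inducedHom_comp_apply _ _ z.1 rfl _).symm

/-- The functor `S^a_*`. -/
noncomputable def algNielsenFunctor : FunctorOn (algNielsenObj Y) where
  map k p := AddCommGrpCat.ofHom (algNielsenHom (morphismMap k) (problemMap_comp k) Y p)
  map_id P := by
    funext p
    ext z
    exact congrArg QuotientAddGroup.mk (inducedHom_id_apply _ rfl z)
  map_comp k l := by
    funext p
    ext z
    exact congrArg QuotientAddGroup.mk (inducedHom_comp_apply _ _ z rfl _).symm

theorem isIso_nielsenFunctor_map {P Q : Over Z} (k : P ⟶ Q)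
    (e : ContinuousMap.HomotopyEquiv P.left Q.left) (he : e.toFun = morphismMap k) :
    IsIso ((nielsenFunctor Y).map k) := by
  refine (isIso_pi_iff _).2 fun p => ?_
  rw [ConcreteCategory.isIso_iff_bijective]
  -- The underlying map of `k` is generalised to a variable so that it can be replaced by `e.toFun`
  -- together with the proof that it lies over `Z`.
  have key : ∀ (m : C(P.left, Q.left)) (hm : (problemMap Q).comp m = problemMap P),
      e.toFun = m → Function.Bijective (nielsenHom m hm Y p) := by
    rintro _ hm rfl
    exact nielsenHom_bijective e hm
  exact key _ (problemMap_comp k) he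

end functors
end HigherNielsen

theorem mainTheorem10 (Z : TopCat.{u}) (Y : Set Z) :
    ∃ (S' : FunctorOn (preNielsenObj Y)) (S : FunctorOn (nielsenObj Y))
      (Sa : FunctorOn (algNielsenObj Y)),
      (∀ (P Q : Over Z) (k : P ⟶ Q) (p : ℕ)
        (s : SingularClosedManifold p (problemMap P ⁻¹' Y)),
        (S'.map k p).hom (nielsenClass s) =
          nielsenClass (s.push (preimageMap (morphismMap k) (problemMap_comp k) Y))) ∧
      (∀ (P Q : Over Z) (k : P ⟶ Q) (p : ℕ) (z : nielsenSubgroup (problemMap P) Y p),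
        ((S.map k p).hom z : nielsenSubgroup (problemMap Q) Y p).1 = (S'.map k p).hom z.1) ∧
      (∀ (P Q : Over Z) (k : P ⟶ Q) (p : ℕ) (z : PreNielsenGroup (problemMap P) Y p),
        (Sa.map k p).hom (QuotientAddGroup.mk z) =
          QuotientAddGroup.mk ((S'.map k p).hom z : PreNielsenGroup (problemMap Q) Y p)) ∧
      (∀ (P Q : Over Z) (k : P ⟶ Q),
        (∃ e : ContinuousMap.HomotopyEquiv P.left Q.left, e.toFun = morphismMap k) →
          IsIso (S.map k)) :=
  ⟨preNielsenFunctor Y, nielsenFunctor Y, algNielsenFunctor Y, fun _ _ _ _ _ => rfl,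
    fun _ _ _ _ _ => rfl, fun _ _ _ _ _ => rfl,
    fun _ _ k ⟨e, he⟩ => isIso_nielsenFunctor_map Y k e he⟩
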